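/- A countable word over a set $S$ is a map $w:\alpha\to S$ from a finite or countable (possibly empty) linear ordering $\alpha$, taken up to isomorphism of labelled orderings; $S^{\circledast}$ is the set of these words, and $\prod_{i\in\alpha}w_i$ is the concatenation of words along $\alpha$, whose domain is the ordered sum of the domains. Put $w^{\omega}=\prod_{i\in\mathbb N}w$, let $w^{\omega*}$ be the concatenation of copies of $w$ along the reverse of $\mathbb N$, and for $k\ge 1$ put $\{w_1,\dots,w_k\}^{\eta}=\prod_{q\in\mathbb Q}w_{f(q)}$, where $f:\mathbb Q\to\{1,\dots,k\}$ is such that every $f^{-1}(i)$ is dense in $\mathbb Q$ (this determines the word up to isomorphism). A $\circledast$-monoid is a set $S$ with a map $\pi:S^{\circledast}\to S$ such that $\pi(a)=a$ for every one-letter word $a$ and $\pi(\prod_{i\in\alpha}\pi(u_i))=\pi(\prod_{i\in\alpha}u_i)$ for every countable family of words $u_i\in S^{\circledast}$. A morphism $h:(S,\pi)\to(S',\pi')$ is a map with $h(\pi(w))=\pi'(\bar h(w))$, where $\bar h$ applies $h$ letter by letter. For every set $A$, $(A^{\circledast},\prod)$ is a $\circledast$-monoid. A $\circledast$-algebra $(M,1,\cdot,\tau,\tau^*,\kappa)$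 consists of a monoid $(M,1,\cdot)$ and maps $\tau,\tau^*:M\to M$ and $\kappa:\mathcal P(M)\setminus\{\emptyset\}\to M$ such that, for all $a,b\in M$, $n>0$, all nonempty $P\subseteq M$, all $c\in P$, all $P'\subseteq P$ and all nonempty $P''\subseteq\{P^\kappa,\ a P^\kappa,\ P^\kappa b,\ aP^\kappa b\mid a,b\in P\}$: $(ab)^\tau=a(ba)^\tau$, $(a^n)^\tau=a^\tau$, $(ba)^{\tau^*}=(ab)^{\tau^*}a$, $(a^n)^{\tau^*}=a^{\tau^*}$; $P^\kappa=P^\kappa P^\kappa=P^\kappa cP^\kappa=(P^\kappa)^\tau=(P^\kappa c)^\tau=(P^\kappa)^{\tau^*}=(cP^\kappa)^{\tau^*}=(P'\cup P'')^\kappa$; $1^\tau=1^{\tau^*}=\{1\}^\kappa=1$ and $P^\kappa=(P\cup\{1\})^\kappa$. A finite $\circledast$-algebra is induced by a $\circledast$-monoid $(M,\pi)$ if $1=\pi(\varepsilon)$, $a\cdot b=\pi(ab)$, $a^\tau=\pi(a^\omega)$, $a^{\tau^*}=\pi(a^{\omega*})$ and $P^\kappa=\pi(P^\eta)$ for all $a,b\in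 M$ and all nonempty $P\subseteq M$. A language $L\subseteq A^{\circledast}$ over a finite alphabet $A$ is recognized by a finite $\circledast$-algebra $M$ through $h_0:A\to M$ and $F\subseteq M$ if $L=h^{-1}(F)$ for some morphism $h:(A^{\circledast},\prod)\to(M,\pi)$ with $h|_A=h_0$, where $(M,\pi)$ is a $\circledast$-monoid inducing the algebra. Theorem. There is an algorithm that, given (the tables of) a finite $\circledast$-algebra $(M,1,\cdot,\tau,\tau^*,\kappa)$, a map $h_0:A\to M$ from a finite alphabet $A$, and a set $F\subseteq M$ through which the algebra recognizes a language $L\subseteq A^{\circledast}$, decides whether $L\neq\emptyset$. Moreover, there is an algorithm that, given the same data, if $L\neq\emptyset$, constructs a finite expression that represents some word in $L$ and is generated by the grammar $$\mathtt w::=\varepsilon\mid a\mid \mathtt w\cdot\mathtt w\mid \mathtt w^{\omega}\mid\mathtt w^{\omega*}\mid\{\mathtt w,\dots,\mathtt w\}^{\eta}\qquad(a\in A),$$ where a shuffle has at least one argument. -/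

import Mathlib

universe u v

namespace OStar

/-! ### Countable words -/

/-- A labelled countable linear ordering: a representative of a countable word over `A`. -/
structure PreWord (A : Type u) : Type (max 1 u) where
  /-- the set of positions -/
  dom : Type
  /-- the ordering of the positions -/
  [ord : LinearOrder dom]
  [cnt : Countable dom]
  /-- the letter at each position -/
  label : dom → A

attribute [instance] PreWord.ord PreWord.cnt

namespace PreWord

/-- Isomorphism of labelled linear orderings. -/
def Iso {A : Type u} (w w' : PreWord A) : Prop :=
  ∃ e : w.dom ≃o w'.dom, ∀ x, w'.label (e x) = w.label x

theorem Iso.refl {A : Type u} (w : PreWord A) : Iso w w :=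
  ⟨OrderIso.refl _, fun _ => rfl⟩

theorem Iso.symm {A : Type u} {w w' : PreWord A} : Iso w w' → Iso w' w := by
  rintro ⟨e, he⟩
  refine ⟨e.symm, fun x => ?_⟩
  rw [← he, OrderIso.apply_symm_apply]

theorem Iso.trans {A : Type u} {w w' w'' : PreWord A} : Iso w w' → Iso w' w'' → Iso w w'' := by
  rintro ⟨e, he⟩ ⟨f, hf⟩
  exact ⟨e.trans f, fun x => by rw [OrderIso.trans_apply, hf, he]⟩

instance setoid (A : Type u) : Setoid (PreWord A) where
  r := Iso
  iseqv := ⟨Iso.refl, Iso.symm, Iso.trans⟩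

/-- Pointwise relabelling. -/
def map {A : Type u} {B : Type v} (f : A → B) (w : PreWord A) : PreWord B where
  dom := w.dom
  label := fun x => f (w.label x)

instance countableLexSigma {ι : Type} [Countable ι] (β : ι → Type) [∀ i, Countable (β i)] :
    Countable (Σₗ i, β i) :=
  inferInstanceAs (Countable (Σ i, β i))

/-- The concatenation `∏_{i ∈ ι} w i`; its domain is the ordered sum of the domains. -/
def prod {A : Type u} (ι : Type) [LinearOrder ι] [Countable ι] (w : ι → PreWord A) :
    PreWord A where
  dom := Σₗ i, (w i).dom
  label := fun x => (w (ofLex x).1).label (ofLex x).2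

theorem prod_iso {A : Type u} {ι κ : Type} [LinearOrder ι] [Countable ι]
    [LinearOrder κ] [Countable κ] (e : ι ≃o κ) (w : ι → PreWord A) (w' : κ → PreWord A)
    (h : ∀ i, Iso (w i) (w' (e i))) : Iso (prod ι w) (prod κ w') := by
  choose f hf using h
  let E : (Σ i, (w i).dom) ≃ (Σ j, (w' j).dom) :=
    Equiv.sigmaCongr e.toEquiv (fun i => (f i).toEquiv)
  have hE : ∀ x : Σ i, (w i).dom, E x = ⟨e x.1, f x.1 x.2⟩ := fun _ => rfl
  have hmono : StrictMono (fun x : Σₗ i, (w i).dom => toLex (E (ofLex x))) := by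
    intro x y hxy
    have hxy' := (Sigma.lex_iff).1 hxy
    refine (Sigma.lex_iff).2 ?_
    rcases x with ⟨i, x⟩
    rcases y with ⟨j, y⟩
    rcases hxy' with h1 | ⟨h1, h2⟩
    · exact Or.inl (e.lt_iff_lt.2 h1)
    · dsimp at h1
      subst h1
      exact Or.inr ⟨rfl, (f i).lt_iff_lt.2 h2⟩
  refine ⟨hmono.orderIsoOfSurjective _ ?_, ?_⟩
  · intro y
    exact ⟨toLex (E.symm (ofLex y)), by simp⟩
  · intro x
    exact hf (ofLex x).1 (ofLex x).2

end PreWord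

/-- `A^⊛`: the words over `A` with countable (possibly empty) domain, up to isomorphism. -/
def Word (A : Type u) : Type (max 1 u) :=
  Quotient (PreWord.setoid A)

namespace Word

/-- The word with domain `ι` and labelling `f`. -/
def of {A : Type u} (ι : Type) [LinearOrder ι] [Countable ι] (f : ι → A) : Word A :=
  Quotient.mk _ ⟨ι, f⟩

/-- Pointwise extension of a map to words. -/
def map {A : Type u} {B : Type v} (f : A → B) : Word A → Word B :=
  Quotient.map (PreWord.map f) (by
    rintro w w' ⟨e, he⟩
    exact ⟨e, fun x => congrArg f (he x)⟩)

/-- The concatenation `∏ : (A^⊛)^⊛ → A^⊛`, sending `(w_i)_{i ∈ α}` to `∏_{i ∈ α} w_i`. -/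
noncomputable def prod {A : Type u} : Word (Word A) → Word A :=
  Quotient.lift
    (fun W : PreWord (Word A) =>
      (Quotient.mk _ (PreWord.prod W.dom fun i => Quotient.out (W.label i)) : Word A))
    (by
      rintro W W' ⟨e, he⟩
      refine Quotient.sound (PreWord.prod_iso e _ _ fun i => ?_)
      rw [he i]
      exact PreWord.Iso.refl _)

/-- On representatives, `prod` is the concatenation of labelled orderings. -/
theorem prod_of {A : Type u} (ι : Type) [LinearOrder ι] [Countable ι] (w : ι → PreWord A) :
    prod (of ι fun i => (Quotient.mk _ (w i) : Word A)) = Quotient.mk _ (PreWord.prod ι w) :=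
  Quotient.sound (PreWord.prod_iso (OrderIso.refl ι) _ _ fun i => Quotient.mk_out (w i))

/-- The empty word. -/
def empty (A : Type u) : Word A := of (Fin 0) Fin.elim0

/-- The one-letter word `a`. -/
def single {A : Type u} (a : A) : Word A := of (Fin 1) fun _ => a

/-- The two-letter word `ab`. -/
def pair {A : Type u} (a b : A) : Word A := of (Fin 2) ![a, b]

/-- The word `a^ω`, with all letters equal to `a` and domain of order type `ω`. -/
def omega {A : Type u} (a : A) : Word A := of ℕ fun _ => a

/-- The word `a^{ω*}`, with all letters equal to `a` and domain of order type `ω*`. -/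
def omegaOp {A : Type u} (a : A) : Word A := of ℕᵒᵈ fun _ => a

/-- `f` is an `η`-shuffle of the letters of `ι`: every letter occurs densely. -/
def IsShuffle {ι : Type u} (f : ℚ → ι) : Prop :=
  ∀ a : ι, ∀ x y : ℚ, x < y → ∃ z : ℚ, x < z ∧ z < y ∧ f z = a

theorem exists_isShuffle (ι : Type u) [Finite ι] [Nonempty ι] :
    ∃ f : ℚ → ι, IsShuffle f := by
  obtain ⟨n, ⟨e⟩⟩ := Finite.exists_equiv_fin ι
  have hn : 0 < n := Fin.pos (e (Classical.arbitrary ι))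
  refine ⟨fun q => e.symm ⟨padicValNat 2 q.den % n, Nat.mod_lt _ hn⟩, fun a x y hxy => ?_⟩
  obtain ⟨N, hN⟩ := exists_nat_gt (2 / (y - x))
  -- an exponent `m ≥ N`, `m > 0` with residue `e a`
  set m : ℕ := (e a : ℕ) + n * (N + 1) with hm
  have hmN : N < m := by nlinarith
  have hd : 0 < y - x := sub_pos.2 hxy
  have h2 : (2 : ℚ) < (y - x) * 2 ^ m := by
    have h3 : (N : ℚ) < 2 ^ m := by
      exact_mod_cast lt_trans hmN Nat.lt_two_pow_self
    have := hN.trans h3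
    rw [div_lt_iff₀ hd] at this
    linarith
  set j : ℤ := ⌊(x * 2 ^ m - 1) / 2⌋ + 1 with hj
  have hp : (0 : ℚ) < 2 ^ m := by positivity
  have hj1 : (x * 2 ^ m - 1) / 2 < j := by rw [hj]; push_cast; exact Int.lt_floor_add_one _
  have hj2 : (j : ℚ) ≤ (x * 2 ^ m - 1) / 2 + 1 := by
    rw [hj]; push_cast; linarith [Int.floor_le ((x * 2 ^ m - 1) / 2)]
  have hden : (((2 * j + 1 : ℤ) : ℚ) / ((2 ^ m : ℤ) : ℚ)).den = 2 ^ m := by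
    have := Rat.den_div_eq_of_coprime (a := 2 * j + 1) (b := 2 ^ m) (by positivity) (by
      rw [Int.natAbs_pow]
      refine Nat.Coprime.pow_right _ ?_
      rw [show (2 : ℤ).natAbs = 2 from rfl, Nat.coprime_two_right, Int.natAbs_odd]
      exact odd_two_mul_add_one j)
    exact_mod_cast this
  refine ⟨((2 * j + 1 : ℤ) : ℚ) / ((2 ^ m : ℤ) : ℚ), ?_, ?_, ?_⟩
  · push_cast
    rw [lt_div_iff₀ hp]
    linarith
  · push_cast
    rw [div_lt_iff₀ hp]
    linarith
  · rw [Equiv.symm_apply_eq]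
    apply Fin.ext
    simp only [hden, padicValNat.prime_pow]
    rw [hm, Nat.add_mul_mod_self_left, Nat.mod_eq_of_lt (e a).2]

/-- The `η`-shuffle of the letters of a finite nonempty set, which is unique up to isomorphism. -/
noncomputable def shuffleLabel (ι : Type u) [Finite ι] [Nonempty ι] : ℚ → ι :=
  (exists_isShuffle ι).choose

/-- The `η`-shuffle `{a_i | i ∈ ι}^η` of a finite nonempty family of letters. -/
noncomputable def shuffle {A : Type u} {ι : Type v} [Finite ι] [Nonempty ι] (a : ι → A) :
    Word A :=
  of ℚ fun q => a (shuffleLabel ι q)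

end Word

/-! ### ⊛-monoids and ⊛-algebras -/

/-- `π : S^⊛ → S` is a generalized product, that is, `(S, π)` is a ⊛-monoid. -/
structure IsProduct {S : Type u} (π : Word S → S) : Prop where
  single : ∀ a, π (Word.single a) = a
  assoc : ∀ W : Word (Word S), π (Word.map π W) = π (Word.prod W)

/-- `h` is a morphism from the ⊛-monoid `(S, π)` to the ⊛-monoid `(S', π')`. -/
def IsMorphism {S : Type u} {S' : Type v} (π : Word S → S) (π' : Word S' → S') (h : S → S') :
    Prop :=
  ∀ w : Word S, h (π w) = π' (Word.map h w)

/-- A ⊛-algebra `(M, 1, ·, τ, τ*, κ)`. -/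
structure Algebra (M : Type u) where
  one : M
  mul : M → M → M
  tau : M → M
  tauOp : M → M
  kappa : {P : Set M // P.Nonempty} → M
  mul_assoc : ∀ a b c, mul a (mul b c) = mul (mul a b) c
  tau_mul : ∀ a b, tau (mul a b) = mul a (tau (mul b a))
  /-- `(mul a)^[n] a` is the power `a ^ (n + 1)`. -/
  tau_pow : ∀ a (n : ℕ), tau ((mul a)^[n] a) = tau a
  tauOp_mul : ∀ a b, tauOp (mul b a) = mul (tauOp (mul a b)) a
  tauOp_pow : ∀ a (n : ℕ), tauOp ((mul a)^[n] a) = tauOp a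
  kappa_mul_kappa : ∀ P, mul (kappa P) (kappa P) = kappa P
  kappa_mul_mul_kappa : ∀ P, ∀ c ∈ P.1, mul (mul (kappa P) c) (kappa P) = kappa P
  tau_kappa : ∀ P, tau (kappa P) = kappa P
  tau_kappa_mul : ∀ P, ∀ c ∈ P.1, tau (mul (kappa P) c) = kappa P
  tauOp_kappa : ∀ P, tauOp (kappa P) = kappa P
  tauOp_mul_kappa : ∀ P, ∀ c ∈ P.1, tauOp (mul c (kappa P)) = kappa P
  kappa_union : ∀ P, ∀ P' ⊆ P.1, ∀ (P'' : Set M) (hP'' : P''.Nonempty),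
    (∀ x ∈ P'', x = kappa P ∨ (∃ a ∈ P.1, x = mul a (kappa P)) ∨
      (∃ b ∈ P.1, x = mul (kappa P) b) ∨
      (∃ a ∈ P.1, ∃ b ∈ P.1, x = mul (mul a (kappa P)) b)) →
    kappa ⟨P' ∪ P'', hP''.inr⟩ = kappa P
  mul_one : ∀ a, mul a one = a
  one_mul : ∀ a, mul one a = a
  tau_one : tau one = one
  tauOp_one : tauOp one = one
  kappa_one : kappa ⟨{one}, Set.singleton_nonempty one⟩ = one
  kappa_union_one : ∀ P, kappa ⟨P.1 ∪ {one}, P.2.inl⟩ = kappa P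

namespace Algebra

/-- The operations of the finite ⊛-algebra `X` are the ones induced by `π`. -/
structure InducedBy {M : Type u} [Finite M] (X : Algebra M) (π : Word M → M) : Prop where
  one_eq : X.one = π (Word.empty M)
  mul_eq : ∀ a b, X.mul a b = π (Word.pair a b)
  tau_eq : ∀ a, X.tau a = π (Word.omega a)
  tauOp_eq : ∀ a, X.tauOp a = π (Word.omegaOp a)
  kappa_eq : ∀ P : {P : Set M // P.Nonempty}, X.kappa P =
    haveI : Nonempty P.1 := P.2.to_subtype
    π (Word.shuffle fun a : P.1 => (a : M))

/-- `L ⊆ A^⊛` is recognized by the finite ⊛-algebra `X` through `h₀ : A → M` and `F ⊆ M`: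
`L = h⁻¹(F)` for a morphism `h` extending `h₀`, from the free ⊛-monoid `(A^⊛, ∏)` to the
⊛-monoid `(M, π)` that induces `X`. -/
def Recognizes {A : Type u} {M : Type v} [Finite M] (X : Algebra M) (h₀ : A → M) (F : Set M)
    (L : Set (Word A)) : Prop :=
  ∃ π : Word M → M, IsProduct π ∧ X.InducedBy π ∧
    ∃ h : Word A → M, IsMorphism Word.prod π h ∧ (∀ a, h (Word.single a) = h₀ a) ∧ L = h ⁻¹' F

end Algebra

/-! ### Expressions -/

/-- Finite expressions `w ::= ε | a | w · w | w^ω | w^{ω*} | {w, …, w}^η`; a shuffle has at least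
one argument, `shuffle k` having `k + 1` of them. -/
inductive Expr (A : Type u) : Type u
  | empty : Expr A
  | letter (a : A) : Expr A
  | concat (e f : Expr A) : Expr A
  | omega (e : Expr A) : Expr A
  | omegaOp (e : Expr A) : Expr A
  | shuffle (k : ℕ) (e : Fin (k + 1) → Expr A) : Expr A

namespace Expr

/-- The word represented by an expression. -/
noncomputable def word {A : Type u} : Expr A → Word A
  | empty => Word.empty A
  | letter a => Word.single a
  | concat e f => Word.prod (Word.pair e.word f.word)
  | omega e => Word.prod (Word.omega e.word)
  | omegaOp e => Word.prod (Word.omegaOp e.word)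
  | shuffle _ e => Word.prod (Word.shuffle fun i => (e i).word)

/-- An expression written in prefix notation as a finite sequence of numbers, the letters being
numbered by `num`. -/
def code {A : Type u} (num : A → ℕ) : Expr A → List ℕ
  | empty => [0]
  | letter a => [1, num a]
  | concat e f => 2 :: (e.code num ++ f.code num)
  | omega e => 3 :: e.code num
  | omegaOp e => 4 :: e.code num
  | shuffle k e => 5 :: k :: (List.ofFn fun i => (e i).code num).flatten

end Expr

/-! ### Instances of the emptiness problem as finite data -/

/-- The finite data describing an instance: the number of elements of `M`, the number of the unit,
the multiplication table, the tables of `τ` and `τ*`, the table of `κ` (a list of pairs of a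
nonempty set, given by the list of its elements, and its value), the images of the letters, and
the list of the elements of `F`. -/
abbrev InstanceCode : Type :=
  ℕ × ℕ × List (List ℕ) × List ℕ × List ℕ × List (List ℕ × ℕ) × List ℕ × List ℕ

open Classical in
/-- The data of the instance `(X, h₀, F)` when `A` and `M` are enumerated by `eA` and `eM`. -/
noncomputable def Algebra.code {A : Type u} {M : Type v} {k n : ℕ} (X : Algebra M) (h₀ : A → M)
    (F : Set M) (eA : A ≃ Fin k) (eM : M ≃ Fin n) : InstanceCode :=
  let num : M → ℕ := fun m => eM m
  let elems : List M := (List.finRange n).map eM.symm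
  (n,
   num X.one,
   elems.map fun a => elems.map fun b => num (X.mul a b),
   elems.map fun a => num (X.tau a),
   elems.map fun a => num (X.tauOp a),
   elems.sublists.filterMap fun l =>
     if hl : {x | x ∈ l}.Nonempty then some (l.map num, num (X.kappa ⟨{x | x ∈ l}, hl⟩)) else none,
   ((List.finRange k).map eA.symm).map fun a => num (h₀ a),
   (elems.filter fun m => m ∈ F).map num)

end OStar

/-! `L` is nonempty exactly when `F` meets the image of `h`, and this image is the least subalgebra
of `M` containing the images of the letters. Saturation reaches that subalgebra within `n` rounds,
where `n` is the number of elements of `M`, and storing with each element the code of an expression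
that produced it yields the witness.

The substance is `Algebra.IsClosed.eval_mem`: a subalgebra `R`, closed only under the finitely many
operations, contains the value of every countable word over `R`. Call two positions linked if all
convex parts between them have value in `R`; this is an equivalence with convex classes. A class has
value in `R`: it is cut at a point, and a Ramsey argument turns a side without an end into a bounded
piece and a power `τ` or `τ*`. Two adjacent classes would be linked, so the classes are densely
ordered. If there were two of them, take an interval of classes whose set of class values is
minimal. Each of its values then occurs in every subinterval, so by Cantor's theorem for labelled
orders the inner classes of any convex part form a shuffle, with value `κ` of a subset of `R`. Hence
the ends of the interval are linked, a contradiction. -/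

namespace OStar

/-! ### Uniqueness of the shuffle -/

section Cantor

variable {α β : Type*} [LinearOrder α] [LinearOrder β] {ι : Type*}

/-- Every label of `ι` occurs between any two points of `α`. -/
def DenseLabel (f : α → ι) : Prop :=
  ∀ a : ι, ∀ x y : α, x < y → ∃ z : α, x < z ∧ z < y ∧ f z = a

/-- A finite set of pairs is the graph of a partial isomorphism of labelled orders. -/
def IsPartialIso (f : α → ι) (g : β → ι) (s : Finset (α × β)) : Prop :=
  ∀ p ∈ s, g p.2 = f p.1 ∧ ∀ q ∈ s, cmp p.1 q.1 = cmp p.2 q.2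

theorem DenseLabel.exists_between_finsets {g : β → ι} (hg : DenseLabel g) [NoMinOrder β]
    [NoMaxOrder β] [Nonempty β] (c : ι) (lo hi : Finset β) (h : ∀ x ∈ lo, ∀ y ∈ hi, x < y) :
    ∃ m : β, (∀ x ∈ lo, x < m) ∧ (∀ y ∈ hi, m < y) ∧ g m = c := by
  have : DenselyOrdered β := ⟨fun x y hxy => by
    obtain ⟨z, h1, h2, -⟩ := hg c x y hxy
    exact ⟨z, h1, h2⟩⟩
  obtain ⟨m, hm1, hm2⟩ := Order.exists_between_finsets lo hi h
  -- `DenseLabel` produces a label only between two given points, so a second point above `m` is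
  -- needed.
  obtain ⟨m', hm1', hm2'⟩ := Order.exists_between_finsets (insert m lo) hi (by
    intro x hx y hy
    rcases Finset.mem_insert.1 hx with rfl | hx
    · exact hm2 y hy
    · exact h x hx y hy)
  obtain ⟨z, h1, h2, h3⟩ := hg c m m' (hm1' m (Finset.mem_insert_self _ _))
  exact ⟨z, fun x hx => (hm1 x hx).trans h1, fun y hy => h2.trans (hm2' y hy), h3⟩

/-- The forth step of the back-and-forth: the image of `a` has to separate two finite sets, the
images of the points below and above `a`, and carry the label `f a`. -/
theorem IsPartialIso.extend {f : α → ι} {g : β → ι} (hg : DenseLabel g) [NoMinOrder β]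
    [NoMaxOrder β] [Nonempty β] {s : Finset (α × β)} (hs : IsPartialIso f g s) (a : α) :
    ∃ b : β, IsPartialIso f g (insert (a, b) s) := by
  by_cases h : ∃ b, (a, b) ∈ s
  · obtain ⟨b, hb⟩ := h
    exact ⟨b, by rwa [Finset.insert_eq_of_mem hb]⟩
  obtain ⟨b, hb1, hb2, hb3⟩ := hg.exists_between_finsets (f a)
    ((s.filter fun p => p.1 < a).image Prod.snd) ((s.filter fun p => a < p.1).image Prod.snd) (by
      intro x hx y hy
      obtain ⟨p, hp, rfl⟩ := Finset.mem_image.1 hx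
      obtain ⟨q, hq, rfl⟩ := Finset.mem_image.1 hy
      rw [Finset.mem_filter] at hp hq
      rw [← lt_iff_lt_of_cmp_eq_cmp ((hs p hp.1).2 q hq.1)]
      exact hp.2.trans hq.2)
  have key : ∀ p ∈ s, cmp p.1 a = cmp p.2 b := by
    rintro ⟨p1, p2⟩ hp
    have hne : p1 ≠ a := fun he => h ⟨p2, he ▸ hp⟩
    rcases lt_or_gt_of_ne hne with hl | hr
    · have h2 : p2 < b :=
        hb1 _ (Finset.mem_image.2 ⟨(p1, p2), Finset.mem_filter.2 ⟨hp, hl⟩, rfl⟩)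
      exact (cmp_eq_lt_iff _ _ |>.2 hl).trans (cmp_eq_lt_iff _ _ |>.2 h2).symm
    · have h2 : b < p2 :=
        hb2 _ (Finset.mem_image.2 ⟨(p1, p2), Finset.mem_filter.2 ⟨hp, hr⟩, rfl⟩)
      exact (cmp_eq_gt_iff _ _ |>.2 hr).trans (cmp_eq_gt_iff _ _ |>.2 h2).symm
  refine ⟨b, fun p hp => ?_⟩
  rcases Finset.mem_insert.1 hp with rfl | hp
  · refine ⟨hb3, fun q hq => ?_⟩
    rcases Finset.mem_insert.1 hq with rfl | hq
    · simp only [cmp_self_eq_eq]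
    · exact cmp_eq_cmp_symm.1 (key q hq)
  · refine ⟨(hs p hp).1, fun q hq => ?_⟩
    rcases Finset.mem_insert.1 hq with rfl | hq
    · exact key p hp
    · exact (hs p hp).2 q hq

theorem IsPartialIso.swap {f : α → ι} {g : β → ι} {s : Finset (α × β)}
    (hs : IsPartialIso f g s) : IsPartialIso g f (s.image Prod.swap) := by
  intro p' hp'
  obtain ⟨p, hp, rfl⟩ := Finset.mem_image.1 hp'
  refine ⟨(hs p hp).1.symm, fun q' hq' => ?_⟩
  obtain ⟨q, hq, rfl⟩ := Finset.mem_image.1 hq'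
  exact ((hs p hp).2 q hq).symm

theorem IsPartialIso.extend_right {f : α → ι} {g : β → ι} (hf : DenseLabel f) [NoMinOrder α]
    [NoMaxOrder α] [Nonempty α] {s : Finset (α × β)} (hs : IsPartialIso f g s) (b : β) :
    ∃ a : α, IsPartialIso f g (insert (a, b) s) := by
  obtain ⟨a, ha⟩ := hs.swap.extend hf b
  refine ⟨a, ?_⟩
  have := ha.swap
  rwa [Finset.image_insert, Finset.image_image, Prod.swap_swap_eq, Finset.image_id] at this

/-- Cantor's theorem for labelled orders: two countable dense orders without endpoints in which
every label occurs densely are isomorphic. -/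
theorem exists_orderIso_of_denseLabel [Countable α] [NoMinOrder α] [NoMaxOrder α] [Nonempty α]
    [Countable β] [NoMinOrder β] [NoMaxOrder β] [Nonempty β] {f : α → ι} {g : β → ι}
    (hf : DenseLabel f) (hg : DenseLabel g) : ∃ e : α ≃o β, ∀ x, g (e x) = f x := by
  cases nonempty_encodable α
  cases nonempty_encodable β
  let P := {s : Finset (α × β) // IsPartialIso f g s}
  -- For each point of either order, the partial isomorphisms defined at it are cofinal. An ideal
  -- meeting all these countably many sets glues to a total isomorphism; directedness puts any two
  -- of its pairs in a common member.
  let cofinals : α ⊕ β → Order.Cofinal P := Sum.elim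
    (fun a => ⟨{s | ∃ b, (a, b) ∈ s.1}, fun s => by
      obtain ⟨b, hb⟩ := s.2.extend hg a
      exact ⟨⟨_, hb⟩, ⟨b, Finset.mem_insert_self _ _⟩, Finset.subset_insert _ _⟩⟩)
    (fun b => ⟨{s | ∃ a, (a, b) ∈ s.1}, fun s => by
      obtain ⟨a, ha⟩ := s.2.extend_right hf b
      exact ⟨⟨_, ha⟩, ⟨a, Finset.mem_insert_self _ _⟩, Finset.subset_insert _ _⟩⟩)
  let I : Order.Ideal P :=
    Order.idealOfCofinals ⟨∅, fun p hp => absurd hp (Finset.notMem_empty p)⟩ cofinals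
  have hF : ∀ a, ∃ b, ∃ s ∈ I, (a, b) ∈ s.1 := fun a => by
    obtain ⟨s, ⟨b, hb⟩, hs⟩ := Order.cofinal_meets_idealOfCofinals
      (⟨∅, fun p hp => absurd hp (Finset.notMem_empty p)⟩ : P) cofinals (Sum.inl a)
    exact ⟨b, s, hs, hb⟩
  have hG : ∀ b, ∃ a, ∃ s ∈ I, (a, b) ∈ s.1 := fun b => by
    obtain ⟨s, ⟨a, ha⟩, hs⟩ := Order.cofinal_meets_idealOfCofinals
      (⟨∅, fun p hp => absurd hp (Finset.notMem_empty p)⟩ : P) cofinals (Sum.inr b)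
    exact ⟨a, s, hs, ha⟩
  choose F hF using hF
  choose G hG using hG
  refine ⟨OrderIso.ofCmpEqCmp F G fun a b => ?_, fun x => ?_⟩
  · obtain ⟨s, hs, ha⟩ := hF a
    obtain ⟨t, ht, hb⟩ := hG b
    obtain ⟨m, _, sm, tm⟩ := I.directed _ hs _ ht
    exact (m.2 (a, F a) (sm ha)).2 (G b, b) (tm hb)
  · obtain ⟨s, -, ha⟩ := hF x
    exact (s.2 _ ha).1

end Cantor

/-! ### Evaluation of words in a ⊛-monoid -/

theorem Word.of_congr {A : Type u} {ι κ : Type} [LinearOrder ι] [Countable ι] [LinearOrder κ]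
    [Countable κ] {f : ι → A} {g : κ → A} (e : ι ≃o κ) (h : ∀ x, g (e x) = f x) :
    Word.of ι f = Word.of κ g :=
  Quotient.sound ⟨e, h⟩

theorem Word.of_eq_empty {A : Type u} {ι : Type} [LinearOrder ι] [Countable ι] [IsEmpty ι]
    (f : ι → A) : Word.of ι f = Word.empty A :=
  Quotient.sound ⟨⟨Equiv.equivOfIsEmpty _ _, fun {a} => isEmptyElim a⟩, fun a => isEmptyElim a⟩

/-- A word is the product of its letters, so a morphism from the free ⊛-monoid is determined by the
images of the letters. -/
theorem Word.prod_of_single {A : Type u} (ι : Type) [LinearOrder ι] [Countable ι] (f : ι → A) :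
    Word.prod (Word.of ι fun i => Word.single (f i)) = Word.of ι f := by
  refine (Word.prod_of ι fun i => ⟨Fin 1, fun _ => f i⟩).trans (Quotient.sound ?_)
  refine ⟨StrictMono.orderIsoOfSurjective (fun x : Σₗ _ : ι, Fin 1 => (ofLex x).1) ?_ ?_,
    fun x => rfl⟩
  · rintro ⟨i, x⟩ ⟨j, y⟩ hxy
    cases (show Sigma.Lex (· < ·) (fun _ => (· < ·)) (⟨i, x⟩ : Σ _ : ι, Fin 1) ⟨j, y⟩ from hxy) with
    | left _ _ h => exact h
    | right _ _ h => exact absurd (Subsingleton.elim (α := Fin 1) _ _) (ne_of_lt (α := Fin 1) h)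
  · intro i
    exact ⟨toLex ⟨i, 0⟩, rfl⟩

theorem Word.prod_empty (A : Type u) : Word.prod (Word.empty (Word A)) = Word.empty A := by
  refine Eq.trans ?_ (Word.prod_of_single (Fin 0) (Fin.elim0 : Fin 0 → A))
  exact congrArg (fun f => Word.prod (Word.of (Fin 0) f)) (funext fun i => i.elim0)

section Eval

variable {M : Type u} {π : Word M → M} {ι : Type} [LinearOrder ι] [Countable ι]

theorem IsProduct.eval_sigma (hπ : IsProduct π) {β : ι → Type} [∀ i, LinearOrder (β i)]
    [∀ i, Countable (β i)] (f : ∀ i, β i → M) :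
    π (Word.of ι fun i => π (Word.of (β i) (f i))) =
      π (Word.of (Σₗ i, β i) fun x => f (ofLex x).1 (ofLex x).2) :=
  (hπ.assoc (Word.of ι fun i => Word.of (β i) (f i))).trans
    (congrArg π (Word.prod_of ι fun i => ⟨β i, f i⟩))

variable (π) in
/-- The value of the restriction of the word `f` to a set of positions. -/
def val (f : ι → M) (s : Set ι) : M :=
  π (Word.of s fun x => f x)

theorem val_univ (f : ι → M) : val π f Set.univ = π (Word.of ι f) :=
  congrArg π (Word.of_congr OrderIso.Set.univ fun _ => rfl)

/-- Generalized associativity in the form used for every factorization: the fibres of a monotone map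
are convex blocks ordered like `κ`. Empty fibres are allowed. -/
theorem IsProduct.val_eq_of_monotone (hπ : IsProduct π) (f : ι → M) {s : Set ι} {κ : Type}
    [LinearOrder κ] [Countable κ] {c : s → κ} (hc : Monotone c) :
    val π f s = π (Word.of κ fun k => val π f {x | ∃ h : x ∈ s, c ⟨x, h⟩ = k}) := by
  refine Eq.trans ?_ (hπ.eval_sigma fun k (x : {x | ∃ h : x ∈ s, c ⟨x, h⟩ = k}) => f x).symm
  refine congrArg π (Word.of_congr (StrictMono.orderIsoOfSurjective
    (fun x : Σₗ k, {x | ∃ h : x ∈ s, c ⟨x, h⟩ = k} =>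
      (⟨(ofLex x).2, (ofLex x).2.2.1⟩ : s)) ?_ ?_) fun x => rfl).symm
  · rintro ⟨k, x⟩ ⟨l, y⟩ hxy
    cases (show Sigma.Lex (· < ·) (fun _ => (· < ·))
      (⟨k, x⟩ : Σ k, {x | ∃ h : x ∈ s, c ⟨x, h⟩ = k}) ⟨l, y⟩ from hxy) with
    | left _ _ h =>
      obtain ⟨x, hx, rfl⟩ := x
      obtain ⟨y, hy, rfl⟩ := y
      exact hc.reflect_lt h
    | right _ _ h => exact h
  · rintro ⟨x, hx⟩
    exact ⟨toLex ⟨c ⟨x, hx⟩, x, hx, rfl⟩, rfl⟩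

variable [Finite M] {X : Algebra M}

theorem Algebra.InducedBy.val_empty (hX : X.InducedBy π) (f : ι → M) : val π f ∅ = X.one :=
  (congrArg π (Word.of_eq_empty _)).trans hX.one_eq.symm

theorem Algebra.InducedBy.val_split (hX : X.InducedBy π) (hπ : IsProduct π) (f : ι → M)
    {s a : Set ι} (h : ∀ x ∈ s, x ∈ a → ∀ y ∈ s, y ∉ a → x < y) :
    val π f s = X.mul (val π f (s ∩ a)) (val π f (s \ a)) := by
  classical
  let c : s → Fin 2 := fun x => if (x : ι) ∈ a then 0 else 1
  have hc : Monotone c := by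
    intro x y hxy
    by_cases hx : (x : ι) ∈ a
    · simp [c, hx]
    · by_cases hy : (y : ι) ∈ a
      · exact absurd (h y y.2 hy x x.2 hx) (not_lt.2 hxy)
      · simp [c, hx, hy]
  rw [hπ.val_eq_of_monotone f hc, hX.mul_eq]
  refine congrArg (fun g => π (Word.of (Fin 2) g)) (funext fun k => ?_)
  match k with
  | 0 =>
    refine congrArg (val π f) (Set.ext fun x => ?_)
    simp [c]
  | 1 =>
    refine congrArg (val π f) (Set.ext fun x => ?_)
    simp [c]

/-- By `exists_orderIso_of_denseLabel` such a word is isomorphic to the shuffle chosen in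
`Word.shuffle`. -/
theorem Algebra.InducedBy.eval_shuffle (hX : X.InducedBy π) {κ : Type} [LinearOrder κ]
    [Countable κ] [NoMinOrder κ] [NoMaxOrder κ] [Nonempty κ] (P : {P : Set M // P.Nonempty})
    (g : κ → M) (hg : ∀ k, g k ∈ P.1)
    (hd : ∀ a ∈ P.1, ∀ x y : κ, x < y → ∃ z, x < z ∧ z < y ∧ g z = a) :
    π (Word.of κ g) = X.kappa P := by
  rw [hX.kappa_eq]
  have : Nonempty P.1 := P.2.to_subtype
  obtain ⟨e, he⟩ := exists_orderIso_of_denseLabel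
    (f := fun k => (⟨g k, hg k⟩ : P.1)) (g := Word.shuffleLabel P.1)
    (by
      rintro ⟨a, ha⟩ x y hxy
      obtain ⟨z, h1, h2, h3⟩ := hd a ha x y hxy
      exact ⟨z, h1, h2, Subtype.ext h3⟩)
    (Word.exists_isShuffle P.1).choose_spec
  exact congrArg π (Word.of_congr e fun x => congrArg Subtype.val (he x))

end Eval

/-! ### Generation of the value of a word -/

/-- In a countable order without maximum, there is a cofinal increasing sequence whose consecutive
pairs all have the same colour. -/
theorem exists_monochromatic_seq {M : Type*} [Finite M] {D : Type*} [LinearOrder D] [Countable D]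
    [Nonempty D] [NoMaxOrder D] (c : D → D → M) :
    ∃ (a : M) (y : ℕ → D), StrictMono y ∧ (∀ d, ∃ n, d < y n) ∧
      ∀ n, c (y n) (y (n + 1)) = a := by
  -- The ultrafilter replaces Ramsey's theorem: `l x` is the colour of `(x, y)` for almost all `y`,
  -- and `a` is the value of `l` almost everywhere. From any `x` with `l x = a`, almost every `y` is
  -- a legal next term; passing the enumeration `d` makes the sequence cofinal.
  let U : Ultrafilter D := Ultrafilter.of Filter.atTop
  have hU : (U : Filter D) ≤ Filter.atTop := Ultrafilter.of_le _
  have hlim : ∀ g : D → M, ∃ b, ∀ᶠ y in (U : Filter D), g y = b := fun g => by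
    obtain ⟨b, hb⟩ := Ultrafilter.eq_pure_of_finite (U.map g)
    refine ⟨b, ?_⟩
    have : ({b} : Set M) ∈ U.map g := by rw [hb]; exact rfl
    exact this
  choose l hl using fun x => hlim (c x)
  obtain ⟨a, ha⟩ := hlim l
  obtain ⟨d, hd⟩ := exists_surjective_nat D
  have step : ∀ (n : ℕ) (x : {x // l x = a}), ∃ x' : {x // l x = a},
      x.1 < x'.1 ∧ d n < x'.1 ∧ c x.1 x'.1 = a := by
    rintro n ⟨x, hx⟩
    obtain ⟨z, h1, h2, h3, h4⟩ := (ha.and ((hl x).and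
      (((Filter.eventually_gt_atTop x).filter_mono hU).and
        ((Filter.eventually_gt_atTop (d n)).filter_mono hU)))).exists
    exact ⟨⟨z, h1⟩, h3, h4, h2.trans hx⟩
  choose next h1 h2 h3 using step
  obtain ⟨x, hx⟩ := ha.exists
  let y : ℕ → {x // l x = a} := fun n => Nat.rec ⟨x, hx⟩ next n
  refine ⟨a, fun n => (y n).1, strictMono_nat_of_lt_succ fun n => h1 n (y n), fun z => ?_,
    fun n => h3 n (y n)⟩
  obtain ⟨n, rfl⟩ := hd z
  exact ⟨n + 1, h2 n (y n)⟩

/-- `R` is a subalgebra of `X`. -/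
structure Algebra.IsClosed {M : Type u} (X : Algebra M) (R : Set M) : Prop where
  one : X.one ∈ R
  mul : ∀ a ∈ R, ∀ b ∈ R, X.mul a b ∈ R
  tau : ∀ a ∈ R, X.tau a ∈ R
  tauOp : ∀ a ∈ R, X.tauOp a ∈ R
  kappa : ∀ P, P.1 ⊆ R → X.kappa P ∈ R

section Generation

variable {M : Type u} {π : Word M → M} {R : Set M} {ι : Type} [LinearOrder ι] [Countable ι]

variable (π R) in
/-- All convex parts of the word `f` between `x` and `y` have their values in `R`. -/
def Linked (f : ι → M) (x y : ι) : Prop :=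
  ∀ t ⊆ Set.uIcc x y, t.OrdConnected → val π f t ∈ R

theorem Linked.symm {f : ι → M} {x y : ι} (h : Linked π R f x y) : Linked π R f y x := by
  intro t ht
  rw [Set.uIcc_comm] at ht
  exact h t ht

variable [Finite M] {X : Algebra M}

theorem Algebra.InducedBy.val_inter_Ici_eq_tau (hX : X.InducedBy π) (hπ : IsProduct π) (f : ι → M)
    {C : Set ι} (hC : C.OrdConnected) {y : ℕ → ι} (hyC : ∀ n, y n ∈ C) (hy : StrictMono y)
    (hcof : ∀ d ∈ C, ∃ n, d < y n) {a : M}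
    (ha : ∀ n, val π f (Set.Ico (y n) (y (n + 1))) = a) :
    val π f (C ∩ Set.Ici (y 0)) = X.tau a := by
  classical
  have hex : ∀ x : ↥(C ∩ Set.Ici (y 0)), ∃ n, y n ≤ x ∧ (x : ι) < y (n + 1) := by
    rintro ⟨x, hxC, hx⟩
    -- The least `n` with `x < y n` is not `0`, because `y 0 ≤ x`; its predecessor is the number of
    -- the block containing `x`.
    have hn := Nat.find_spec (hcof x hxC)
    have hmin := fun m => Nat.find_min (hcof x hxC) (m := m)
    rcases hk : Nat.find (hcof x hxC) with _ | k
    · rw [hk] at hn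
      exact absurd hn (not_lt.2 hx)
    · rw [hk] at hn hmin
      exact ⟨k, not_lt.1 (hmin k (Nat.lt_succ_self k)), hn⟩
  choose c hc1 hc2 using hex
  have hle : ∀ {x : ι} {m n : ℕ}, y m ≤ x → x < y (n + 1) → m ≤ n := fun h1 h2 =>
    Nat.lt_succ_iff.1 (hy.lt_iff_lt.1 (h1.trans_lt h2))
  rw [hπ.val_eq_of_monotone f (c := c) fun x x' h => hle (hc1 x) (lt_of_le_of_lt h (hc2 x')),
    hX.tau_eq]
  refine congrArg (fun g => π (Word.of ℕ g)) (funext fun k => ?_)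
  rw [← ha k]
  refine congrArg (val π f) (Set.ext fun x => ⟨?_, ?_⟩)
  · rintro ⟨h, rfl⟩
    exact ⟨hc1 ⟨x, h⟩, hc2 ⟨x, h⟩⟩
  · rintro ⟨h1, h2⟩
    have hx : x ∈ C ∩ Set.Ici (y 0) :=
      ⟨hC.out (hyC k) (hyC (k + 1)) ⟨h1, h2.le⟩, (hy.monotone (Nat.zero_le k)).trans h1⟩
    exact ⟨hx, le_antisymm (hle (hc1 ⟨x, hx⟩) h2) (hle h1 (hc2 ⟨x, hx⟩))⟩

/-- Mirror image of the previous lemma: blocks are closed on the right, and are numbered in `ℕᵒᵈ`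
because larger indices lie further left. -/
theorem Algebra.InducedBy.val_inter_Iic_eq_tauOp (hX : X.InducedBy π) (hπ : IsProduct π)
    (f : ι → M) {C : Set ι} (hC : C.OrdConnected) {y : ℕ → ι} (hyC : ∀ n, y n ∈ C)
    (hy : StrictAnti y) (hcof : ∀ d ∈ C, ∃ n, y n < d) {a : M}
    (ha : ∀ n, val π f (Set.Ioc (y (n + 1)) (y n)) = a) :
    val π f (C ∩ Set.Iic (y 0)) = X.tauOp a := by
  classical
  have hex : ∀ x : ↥(C ∩ Set.Iic (y 0)), ∃ n, (x : ι) ≤ y n ∧ y (n + 1) < x := by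
    rintro ⟨x, hxC, hx⟩
    have hn := Nat.find_spec (hcof x hxC)
    have hmin := fun m => Nat.find_min (hcof x hxC) (m := m)
    rcases hk : Nat.find (hcof x hxC) with _ | k
    · rw [hk] at hn
      exact absurd hn (not_lt.2 hx)
    · rw [hk] at hn hmin
      exact ⟨k, not_lt.1 (hmin k (Nat.lt_succ_self k)), hn⟩
  choose c hc1 hc2 using hex
  have hle : ∀ {x : ι} {m n : ℕ}, x ≤ y m → y (n + 1) < x → m ≤ n := fun h1 h2 =>
    Nat.lt_succ_iff.1 (hy.lt_iff_gt.1 (h2.trans_le h1))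
  rw [hπ.val_eq_of_monotone f (c := fun x => OrderDual.toDual (c x)) fun x x' h =>
      OrderDual.toDual_le_toDual.2 (hle (hc1 x') (lt_of_lt_of_le (hc2 x) h)), hX.tauOp_eq]
  refine congrArg (fun g => π (Word.of ℕᵒᵈ g)) (funext fun k => ?_)
  rw [← ha (OrderDual.ofDual k)]
  refine congrArg (val π f) (Set.ext fun x => ⟨?_, ?_⟩)
  · rintro ⟨h, rfl⟩
    exact ⟨hc2 ⟨x, h⟩, hc1 ⟨x, h⟩⟩
  · rintro ⟨h1, h2⟩
    have hx : x ∈ C ∩ Set.Iic (y 0) :=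
      ⟨hC.out (hyC (k.ofDual + 1)) (hyC k.ofDual) ⟨h1.le, h2⟩,
        h2.trans (hy.antitone (Nat.zero_le k.ofDual))⟩
    exact ⟨hx, congrArg OrderDual.toDual
      (le_antisymm (hle (hc1 ⟨x, hx⟩) h1) (hle h2 (hc2 ⟨x, hx⟩)))⟩

theorem Algebra.IsClosed.val_mem_of_split (hR : X.IsClosed R) (hX : X.InducedBy π)
    (hπ : IsProduct π) {f : ι → M} {t a : Set ι} (h : ∀ x ∈ t, x ∈ a → ∀ y ∈ t, y ∉ a → x < y)
    (h1 : val π f (t ∩ a) ∈ R) (h2 : val π f (t \ a) ∈ R) : val π f t ∈ R := by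
  rw [hX.val_split hπ f h]
  exact hR.mul _ h1 _ h2

theorem Algebra.IsClosed.linked_refl (hR : X.IsClosed R) (hX : X.InducedBy π)
    (hπ : IsProduct π) {f : ι → M} (hf : ∀ i, f i ∈ R) (x : ι) : Linked π R f x x := by
  intro t ht _
  rw [Set.uIcc_self] at ht
  rcases Set.subset_singleton_iff_eq.1 ht with rfl | rfl
  · rw [hX.val_empty]
    exact hR.one
  · have : val π f {x} = f x := by
      refine Eq.trans (congrArg π ?_) (hπ.single (f x))
      refine (Word.of_congr (OrderIso.ofUnique (Fin 1) ({x} : Set ι)) fun _ => ?_).symm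
      exact congrArg f (Subtype.prop (p := (· ∈ ({x} : Set ι))) _)
    rw [this]
    exact hf x

/-- A convex part between `x` and `z` is cut at `y`. Each half lies between `x` and `y` or between
`y` and `z`, wherever `y` is; if `y` is not between `x` and `z`, one half may be empty. -/
theorem Algebra.IsClosed.linked_trans (hR : X.IsClosed R) (hX : X.InducedBy π)
    (hπ : IsProduct π) {f : ι → M} {x y z : ι} (hxy : Linked π R f x y)
    (hyz : Linked π R f y z) : Linked π R f x z := by
  intro t ht hc
  refine hR.val_mem_of_split hX hπ (a := Set.Iic y)
    (fun a _ ha b _ hb => lt_of_le_of_lt ha (not_le.1 hb)) ?_ ?_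
  · have hc' : (t ∩ Set.Iic y).OrdConnected := hc.inter Set.ordConnected_Iic
    rcases le_total x z with hxz | hxz
    · refine hxy _ (fun a ha => ?_) hc'
      have h1 := ht ha.1
      rw [Set.uIcc_of_le hxz] at h1
      exact Set.Icc_subset_uIcc ⟨h1.1, ha.2⟩
    · refine hyz _ (fun a ha => ?_) hc'
      have h1 := ht ha.1
      rw [Set.uIcc_of_ge hxz] at h1
      exact Set.Icc_subset_uIcc' ⟨h1.1, ha.2⟩
  · have hc' : (t \ Set.Iic y).OrdConnected := by
      rw [Set.sdiff_eq, Set.compl_Iic]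
      exact hc.inter Set.ordConnected_Ioi
    rcases le_total x z with hxz | hxz
    · refine hyz _ (fun a ha => ?_) hc'
      have h1 := ht ha.1
      rw [Set.uIcc_of_le hxz] at h1
      exact Set.Icc_subset_uIcc ⟨(not_le.1 ha.2).le, h1.2⟩
    · refine hxy _ (fun a ha => ?_) hc'
      have h1 := ht ha.1
      rw [Set.uIcc_of_ge hxz] at h1
      exact Set.Icc_subset_uIcc' ⟨(not_le.1 ha.2).le, h1.2⟩

/-- If `C` has a maximum, the part lies between two linked positions. Otherwise it is a bounded
piece followed by an `ω`-sequence of blocks of equal value. -/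
theorem Algebra.IsClosed.val_inter_Ici_mem (hR : X.IsClosed R) (hX : X.InducedBy π)
    (hπ : IsProduct π) {f : ι → M} {C : Set ι} (hC : C.OrdConnected)
    (h : ∀ x ∈ C, ∀ y ∈ C, Linked π R f x y) {x : ι} (hx : x ∈ C) :
    val π f (C ∩ Set.Ici x) ∈ R := by
  by_cases hmax : ∃ m ∈ C, ∀ z ∈ C, z ≤ m
  · obtain ⟨m, hm, hmax⟩ := hmax
    exact h x hx m hm _ (fun z hz => Set.Icc_subset_uIcc ⟨hz.2, hmax z hz.1⟩)
      (hC.inter Set.ordConnected_Ici)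
  push Not at hmax
  have : Nonempty C := ⟨⟨x, hx⟩⟩
  have : NoMaxOrder C := ⟨fun m => by
    obtain ⟨z, hz, hlt⟩ := hmax m m.2
    exact ⟨⟨z, hz⟩, hlt⟩⟩
  obtain ⟨a, y, hy, hcof, ha⟩ :=
    exists_monochromatic_seq fun p q : C => val π f (Set.Ico (p : ι) q)
  obtain ⟨N, hN⟩ := hcof ⟨x, hx⟩
  have hN' : x < y N := hN
  -- Shifting the sequence by `N` makes it start beyond `x`.
  have htau : val π f (C ∩ Set.Ici (y N : ι)) = X.tau a := by
    have := hX.val_inter_Ici_eq_tau hπ f hC (y := fun n => (y (n + N) : ι)) (a := a)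
      (fun n => (y (n + N)).2)
      (fun m n hmn => hy (Nat.add_lt_add_right hmn N))
      (fun d hd => by
        obtain ⟨n, hn⟩ := hcof ⟨d, hd⟩
        exact ⟨n, lt_of_lt_of_le hn (hy.monotone (Nat.le_add_right n N))⟩)
      (fun n => by
        have := ha (n + N)
        rwa [show n + N + 1 = n + 1 + N by omega] at this)
    simpa using this
  refine hR.val_mem_of_split hX hπ (a := Set.Iio (y N : ι))
    (fun a _ ha b _ hb => lt_of_lt_of_le ha (not_lt.1 hb)) ?_ ?_
  · exact h x hx _ (y N).2 _ (fun z hz => Set.Icc_subset_uIcc ⟨hz.1.2, le_of_lt hz.2⟩)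
      ((hC.inter Set.ordConnected_Ici).inter Set.ordConnected_Iio)
  · have hs : (C ∩ Set.Ici x) \ Set.Iio (y N : ι) = C ∩ Set.Ici (y N : ι) := by
      ext z
      simp only [Set.mem_sdiff, Set.mem_inter_iff, Set.mem_Ici, Set.mem_Iio, not_lt]
      exact ⟨fun hz => ⟨hz.1.1, hz.2⟩, fun hz => ⟨⟨hz.1, hN'.le.trans hz.2⟩, hz.2⟩⟩
    rw [hs, htau]
    refine hR.tau _ ?_
    rw [← ha 0]
    exact h _ (y 0).2 _ (y 1).2 _ (fun z hz => Set.Icc_subset_uIcc ⟨hz.1, hz.2.le⟩)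
      Set.ordConnected_Ico

theorem Algebra.IsClosed.val_inter_Iio_mem (hR : X.IsClosed R) (hX : X.InducedBy π)
    (hπ : IsProduct π) {f : ι → M} {C : Set ι} (hC : C.OrdConnected)
    (h : ∀ x ∈ C, ∀ y ∈ C, Linked π R f x y) {x : ι} (hx : x ∈ C) :
    val π f (C ∩ Set.Iio x) ∈ R := by
  by_cases hmin : ∃ m ∈ C, ∀ z ∈ C, m ≤ z
  · obtain ⟨m, hm, hmin⟩ := hmin
    exact h m hm x hx _ (fun z hz => Set.Icc_subset_uIcc ⟨hmin z hz.1, le_of_lt hz.2⟩)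
      (hC.inter Set.ordConnected_Iio)
  push Not at hmin
  have : Nonempty (↥C)ᵒᵈ := ⟨OrderDual.toDual ⟨x, hx⟩⟩
  have : NoMinOrder C := ⟨fun m => by
    obtain ⟨z, hz, hlt⟩ := hmin m m.2
    exact ⟨⟨z, hz⟩, hlt⟩⟩
  have : Countable (↥C)ᵒᵈ := inferInstanceAs (Countable C)
  -- The colouring lemma in the dual order gives a decreasing sequence that is coinitial in `C`.
  obtain ⟨a, y', hy', hcof', ha'⟩ :=
    exists_monochromatic_seq fun p q : (↥C)ᵒᵈ =>
      val π f (Set.Ioc ((OrderDual.ofDual q : C) : ι) (OrderDual.ofDual p : C))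
  obtain ⟨y, hy, hcof, ha⟩ : ∃ y : ℕ → C, StrictAnti y ∧ (∀ d, ∃ n, y n < d) ∧
      ∀ n, val π f (Set.Ioc (y (n + 1) : ι) (y n)) = a :=
    ⟨fun n => OrderDual.ofDual (y' n), fun m n hmn => hy' hmn,
      fun d => hcof' (OrderDual.toDual d), ha'⟩
  obtain ⟨N, hN⟩ := hcof ⟨x, hx⟩
  have hN' : y N < x := hN
  have htau : val π f (C ∩ Set.Iic (y N : ι)) = X.tauOp a := by
    have := hX.val_inter_Iic_eq_tauOp hπ f hC (y := fun n => (y (n + N) : ι)) (a := a)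
      (fun n => (y (n + N)).2)
      (fun m n hmn => hy (Nat.add_lt_add_right hmn N))
      (fun d hd => by
        obtain ⟨n, hn⟩ := hcof ⟨d, hd⟩
        exact ⟨n, lt_of_le_of_lt (hy.antitone (Nat.le_add_right n N)) hn⟩)
      (fun n => by
        have := ha (n + N)
        rwa [show n + N + 1 = n + 1 + N by omega] at this)
    simpa using this
  refine hR.val_mem_of_split hX hπ (a := Set.Iic (y N : ι))
    (fun a _ ha b _ hb => lt_of_le_of_lt ha (not_le.1 hb)) ?_ ?_
  · have hs : (C ∩ Set.Iio x) ∩ Set.Iic (y N : ι) = C ∩ Set.Iic (y N : ι) := by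
      ext z
      simp only [Set.mem_inter_iff, Set.mem_Iic, Set.mem_Iio]
      exact ⟨fun hz => ⟨hz.1.1, hz.2⟩, fun hz => ⟨⟨hz.1, hz.2.trans_lt hN'⟩, hz.2⟩⟩
    rw [hs, htau]
    refine hR.tauOp _ ?_
    rw [← ha 0]
    exact h _ (y 1).2 _ (y 0).2 _ (fun z hz => Set.Icc_subset_uIcc ⟨hz.1.le, hz.2⟩)
      Set.ordConnected_Ioc
  · refine h _ (y N).2 x hx _
      (fun z hz => Set.Icc_subset_uIcc ⟨(not_le.1 hz.2).le, le_of_lt hz.1.2⟩) ?_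
    rw [Set.sdiff_eq, Set.compl_Iic]
    exact (hC.inter Set.ordConnected_Iio).inter Set.ordConnected_Ioi

theorem Algebra.IsClosed.val_mem_of_linked (hR : X.IsClosed R) (hX : X.InducedBy π)
    (hπ : IsProduct π) {f : ι → M} {C : Set ι} (hC : C.OrdConnected)
    (h : ∀ x ∈ C, ∀ y ∈ C, Linked π R f x y) : val π f C ∈ R := by
  rcases C.eq_empty_or_nonempty with rfl | ⟨x, hx⟩
  · rw [hX.val_empty]
    exact hR.one
  refine hR.val_mem_of_split hX hπ (a := Set.Iio x)
    (fun a _ ha b _ hb => lt_of_lt_of_le ha (not_lt.1 hb))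
    (hR.val_inter_Iio_mem hX hπ hC h hx) ?_
  rw [Set.sdiff_eq, Set.compl_Iio]
  exact hR.val_inter_Ici_mem hX hπ hC h hx

/-- A map choosing a representative in each class of linked positions. -/
theorem Algebra.IsClosed.exists_representative (hR : X.IsClosed R) (hX : X.InducedBy π)
    (hπ : IsProduct π) {f : ι → M} (hf : ∀ i, f i ∈ R) :
    ∃ r : ι → ι, Monotone r ∧ (∀ x, r (r x) = r x) ∧
      ∀ x y, r x = r y ↔ Linked π R f x y := by
  let S : Setoid ι := ⟨Linked π R f, hR.linked_refl hX hπ hf, Linked.symm,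
    hR.linked_trans hX hπ⟩
  -- Classes are represented by positions, so the quotient inherits its order from `ι`.
  let r : ι → ι := fun x => (Quotient.mk S x).out
  have hr : ∀ x, Linked π R f (r x) x := fun x => Quotient.mk_out (s := S) x
  have hiff : ∀ x y, r x = r y ↔ Linked π R f x y := fun x y =>
    ⟨fun h => hR.linked_trans hX hπ (hr x).symm (h ▸ hr y),
      fun h => congrArg Quotient.out (Quotient.sound (s := S) h)⟩
  refine ⟨r, fun x y hxy => ?_, fun x => (hiff _ _).2 (hr x), hiff⟩
  by_contra hlt
  push Not at hlt
  refine absurd ((hiff x y).2 ?_) (ne_of_gt hlt)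
  -- With `x ≤ y` and `r y < r x`, the interval from `r x` to `y` lies inside the one from `r y` to
  -- `y`, or the interval from `x` to `y` inside the one from `x` to `r x`; both larger intervals
  -- have linked ends.
  rcases le_total (r x) y with h | h
  · have h1 : Linked π R f (r y) y := hr y
    have h2 : Linked π R f (r x) y := fun t ht => h1 t (ht.trans (by
      rw [Set.uIcc_of_le h, Set.uIcc_of_le (hlt.le.trans h)]
      exact Set.Icc_subset_Icc_left hlt.le))
    exact hR.linked_trans hX hπ (hr x).symm h2
  · have h1 : Linked π R f (r x) x := hr x
    exact fun t ht => h1 t (ht.trans (by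
      rw [Set.uIcc_of_le hxy, Set.uIcc_of_ge (hxy.trans h)]
      exact Set.Icc_subset_Icc_right h))

theorem Algebra.IsClosed.val_mem_of_representative_eq (hR : X.IsClosed R) (hX : X.InducedBy π)
    (hπ : IsProduct π) {f : ι → M} {r : ι → ι} (hr : ∀ x y, r x = r y → Linked π R f x y)
    {t : Set ι} (ht : t.OrdConnected) (k : ι) (hk : ∀ x ∈ t, r x = k) : val π f t ∈ R :=
  hR.val_mem_of_linked hX hπ ht fun x hx y hy => hr x y ((hk x hx).trans (hk y hy).symm)

/-- Two positions that are not linked are separated by a third class. -/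
theorem Algebra.IsClosed.exists_between_representatives (hR : X.IsClosed R)
    (hX : X.InducedBy π) (hπ : IsProduct π) {f : ι → M} {r : ι → ι} (hmono : Monotone r)
    (hr : ∀ x y, r x = r y ↔ Linked π R f x y) {p q : ι} (hpq : r p < r q) :
    ∃ z, r p < r z ∧ r z < r q := by
  by_contra hno
  push Not at hno
  have hlt := hmono.reflect_lt hpq
  -- With no class in between, a convex part between `p` and `q` is a piece of the class of `p`
  -- followed by a piece of the class of `q`, so `p` and `q` would be linked.
  refine hpq.ne ((hr p q).2 fun t ht hc => ?_)
  rw [Set.uIcc_of_le hlt.le] at ht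
  have hcls : ∀ k, (r ⁻¹' {k}).OrdConnected := fun k =>
    Set.ordConnected_singleton.preimage_mono hmono
  have hq : ∀ x ∈ t, r x ≠ r p → r x = r q := fun x hx hne =>
    le_antisymm (hmono (ht hx).2) (hno x (lt_of_le_of_ne (hmono (ht hx).1) hne.symm))
  have hdiff : t \ r ⁻¹' {r p} = t ∩ r ⁻¹' {r q} := by
    ext x
    refine ⟨fun hx => ⟨hx.1, hq x hx.1 hx.2⟩, fun hx => ⟨hx.1, fun h => hpq.ne ?_⟩⟩
    exact (show r x = r p from h).symm.trans hx.2
  refine hR.val_mem_of_split hX hπ (a := r ⁻¹' {r p}) (fun x hx hxa y hy hya => ?_) ?_ ?_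
  · refine hmono.reflect_lt ?_
    rw [show r x = r p from hxa, hq y hy hya]
    exact hpq
  · exact hR.val_mem_of_representative_eq hX hπ (fun x y => (hr x y).1) (hc.inter (hcls _)) (r p)
      fun x hx => hx.2
  · rw [hdiff]
    exact hR.val_mem_of_representative_eq hX hπ (fun x y => (hr x y).1) (hc.inter (hcls _)) (r q)
      fun x hx => hx.2

/-- A convex union of classes, without first and last class, in which every class value occurs
densely, has the value of a shuffle. -/
theorem Algebra.InducedBy.val_eq_kappa (hX : X.InducedBy π) (hπ : IsProduct π) {f : ι → M}
    {r : ι → ι} (hmono : Monotone r) (hidem : ∀ x, r (r x) = r x) {s : Set ι} (hs : s.Nonempty)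
    (hsat : ∀ x, r x ∈ s ↔ x ∈ s) (P : {P : Set M // P.Nonempty})
    (hP : ∀ x ∈ s, val π f (r ⁻¹' {r x}) ∈ P.1) (hmin : ∀ x ∈ s, ∃ y ∈ s, r y < r x)
    (hmax : ∀ x ∈ s, ∃ y ∈ s, r x < r y)
    (hd : ∀ a ∈ P.1, ∀ x ∈ s, ∀ y ∈ s, r x < r y →
      ∃ z ∈ s, r x < r z ∧ r z < r y ∧ val π f (r ⁻¹' {r z}) = a) :
    val π f s = X.kappa P := by
  -- The fixed points of `r` in `s` are the classes contained in `s`.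
  let κ : Type := {k : ι // k ∈ s ∧ r k = k}
  let c : s → κ := fun x => ⟨r x, (hsat x).2 x.2, hidem x⟩
  have hc : Monotone c := fun x y h => hmono h
  rw [hπ.val_eq_of_monotone f hc]
  have hfib : ∀ k : κ, {x | ∃ h : x ∈ s, c ⟨x, h⟩ = k} = r ⁻¹' {r k} := by
    rintro ⟨k, hk, hrk⟩
    ext x
    constructor
    · rintro ⟨h, hx⟩
      exact (congrArg Subtype.val hx).trans hrk.symm
    · intro (hx : r x = r k)
      have hxs : x ∈ s := (hsat x).1 (by rw [hx, hrk]; exact hk)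
      exact ⟨hxs, Subtype.ext (hx.trans hrk)⟩
  simp only [hfib]
  have : Nonempty κ := hs.elim fun x hx => ⟨c ⟨x, hx⟩⟩
  have : NoMinOrder κ := ⟨fun k => by
    obtain ⟨y, hy, h⟩ := hmin k k.2.1
    exact ⟨c ⟨y, hy⟩, show r y < k.1 from k.2.2 ▸ h⟩⟩
  have : NoMaxOrder κ := ⟨fun k => by
    obtain ⟨y, hy, h⟩ := hmax k k.2.1
    exact ⟨c ⟨y, hy⟩, show k.1 < r y from k.2.2 ▸ h⟩⟩
  refine hX.eval_shuffle P _ (fun k => hP k k.2.1) fun a ha x y hxy => ?_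
  obtain ⟨z, hz, h1, h2, h3⟩ := hd a ha x x.2.1 y y.2.1 (by
    rw [x.2.2, y.2.2]
    exact hxy)
  rw [x.2.2] at h1
  rw [y.2.2] at h2
  exact ⟨c ⟨z, hz⟩, h1, h2, by rw [← h3]; exact congrArg (fun k => val π f (r ⁻¹' {k})) (hidem z)⟩

/-- All positions of a word with letters in a subalgebra are linked. -/
theorem Algebra.IsClosed.linked (hR : X.IsClosed R) (hX : X.InducedBy π) (hπ : IsProduct π)
    {f : ι → M} (hf : ∀ i, f i ∈ R) (x₀ y₀ : ι) : Linked π R f x₀ y₀ := by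
  obtain ⟨r, hmono, hidem, hr⟩ := hR.exists_representative hX hπ hf
  have hcls : ∀ k, (r ⁻¹' {k}).OrdConnected := fun k =>
    Set.ordConnected_singleton.preimage_mono hmono
  have hval : ∀ {t : Set ι}, t.OrdConnected → ∀ k, (∀ x ∈ t, r x = k) → val π f t ∈ R :=
    fun ht k => hR.val_mem_of_representative_eq hX hπ (fun x y => (hr x y).1) ht k
  have hbetween : ∀ {p q : ι}, r p < r q → ∃ z, r p < r z ∧ r z < r q :=
    fun h => hR.exists_between_representatives hX hπ hmono hr h
  let v : ι → M := fun z => val π f (r ⁻¹' {r z})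
  let W : ι → ι → Set M := fun p q => v '' {z | r p < r z ∧ r z < r q}
  refine (hr x₀ y₀).1 ?_
  by_contra hne
  obtain ⟨p₀, q₀, hpq₀⟩ : ∃ p q, r p < r q := by
    rcases lt_or_gt_of_ne hne with h | h
    · exact ⟨_, _, h⟩
    · exact ⟨_, _, h⟩
  -- As `M` is finite, some interval of classes has an inclusion-minimal set of values. All its
  -- subintervals then have the same set, which is the density needed for a shuffle.
  obtain ⟨w, ⟨p, q, hpq, rfl⟩, hmin⟩ := WellFounded.has_min
    (wellFounded_lt (α := Set M)) {w | ∃ p q, r p < r q ∧ w = W p q} ⟨_, p₀, q₀, hpq₀, rfl⟩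
  have hW : ∀ {p' q'}, r p ≤ r p' → r p' < r q' → r q' ≤ r q → W p' q' = W p q := by
    intro p' q' h1 h2 h3
    have hsub : W p' q' ⊆ W p q :=
      Set.image_mono fun z hz => ⟨h1.trans_lt hz.1, hz.2.trans_le h3⟩
    by_contra hne'
    exact hmin _ ⟨p', q', h2, rfl⟩ (lt_of_le_of_ne hsub hne')
  have hWne : (W p q).Nonempty := by
    obtain ⟨z, hz⟩ := hbetween hpq
    exact ⟨_, z, hz, rfl⟩
  have hWR : W p q ⊆ R := by
    rintro _ ⟨z, -, rfl⟩
    exact hval (hcls _) _ fun x hx => hx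
  refine hpq.ne ((hr p q).2 fun t ht hc => ?_)
  rw [Set.uIcc_of_le (hmono.reflect_lt hpq).le] at ht
  -- The part `t` splits into a piece of its first class, the complete classes in between, and a
  -- piece of its last class. Any of the three may be empty.
  let lo : Set ι := {z | ∀ a ∈ t, r z ≤ r a}
  let hi : Set ι := {z | ∀ b ∈ t, r b ≤ r z}
  let mid : Set ι := {z | z ∈ t ∧ (∃ a ∈ t, r a < r z) ∧ ∃ b ∈ t, r z < r b}
  have hmid : (t \ lo) ∩ hiᶜ = mid := by
    ext z
    simp only [lo, hi, mid, Set.mem_inter_iff, Set.mem_sdiff, Set.mem_ofPred_eq, Set.mem_compl_iff,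
      not_forall, not_le, exists_prop, and_assoc]
  refine hR.val_mem_of_split hX hπ (a := lo) (fun x hx hxl y hy hyl => ?_) ?_ ?_
  · simp only [lo, Set.mem_ofPred_eq, not_forall, not_le] at hyl
    obtain ⟨a, ha, hlt⟩ := hyl
    exact hmono.reflect_lt ((hxl a ha).trans_lt hlt)
  · rcases (t ∩ lo).eq_empty_or_nonempty with h | ⟨z, hz⟩
    · rw [h, hX.val_empty]
      exact hR.one
    have heq : t ∩ lo = t ∩ r ⁻¹' {r z} := by
      ext x
      refine ⟨fun hx => ⟨hx.1, le_antisymm (hx.2 z hz.1) (hz.2 x hx.1)⟩, fun hx => ⟨hx.1, ?_⟩⟩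
      intro a ha
      rw [show r x = r z from hx.2]
      exact hz.2 a ha
    rw [heq]
    exact hval (hc.inter (hcls _)) (r z) fun x hx => hx.2
  refine hR.val_mem_of_split hX hπ (a := hiᶜ) (fun x hx hxh y hy hyh => ?_) ?_ ?_
  · simp only [hi, Set.mem_compl_iff, Set.mem_ofPred_eq, not_forall, not_le] at hxh
    obtain ⟨b, hb, hlt⟩ := hxh
    exact hmono.reflect_lt (hlt.trans_le (Set.notMem_compl_iff.1 hyh b hb))
  · rw [hmid]
    rcases mid.eq_empty_or_nonempty with h | hne'
    · rw [h, hX.val_empty]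
      exact hR.one
    have hmem : ∀ {a b z : ι}, a ∈ t → b ∈ t → r a < r z → r z < r b → z ∈ mid :=
      fun ha hb h1 h2 =>
        ⟨hc.out ha hb ⟨(hmono.reflect_lt h1).le, (hmono.reflect_lt h2).le⟩, ⟨_, ha, h1⟩, _, hb, h2⟩
    have hpt : ∀ {z}, z ∈ t → r p ≤ r z ∧ r z ≤ r q := fun hz => ⟨hmono (ht hz).1, hmono (ht hz).2⟩
    have hkappa : val π f mid = X.kappa ⟨W p q, hWne⟩ := by
      refine hX.val_eq_kappa hπ hmono hidem hne' (fun x => ?_) _ ?_ ?_ ?_ ?_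
      · constructor
        · rintro ⟨-, ⟨a, ha, h1⟩, b, hb, h2⟩
          rw [hidem] at h1 h2
          exact hmem ha hb h1 h2
        · rintro ⟨-, ⟨a, ha, h1⟩, b, hb, h2⟩
          exact hmem ha hb (by rwa [hidem]) (by rwa [hidem])
      · rintro x ⟨-, ⟨a, ha, h1⟩, b, hb, h2⟩
        exact ⟨x, ⟨(hpt ha).1.trans_lt h1, h2.trans_le (hpt hb).2⟩, rfl⟩
      · rintro x ⟨-, ⟨a, ha, h1⟩, b, hb, h2⟩
        obtain ⟨z, hz1, hz2⟩ := hbetween h1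
        exact ⟨z, hmem ha hb hz1 (hz2.trans h2), hz2⟩
      · rintro x ⟨-, ⟨a, ha, h1⟩, b, hb, h2⟩
        obtain ⟨z, hz1, hz2⟩ := hbetween h2
        exact ⟨z, hmem ha hb (h1.trans hz1) hz2, hz1⟩
      · intro a ha x hx y hy hxy
        replace ha : a ∈ W x y := (hW (hpt hx.1).1 hxy (hpt hy.1).2).ge ha
        obtain ⟨z, ⟨hz1, hz2⟩, rfl⟩ := ha
        exact ⟨z, hmem hx.1 hy.1 hz1 hz2, hz1, hz2, rfl⟩
    rw [hkappa]
    exact hR.kappa _ hWR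
  · rw [Set.sdiff_compl]
    rcases ((t \ lo) ∩ hi).eq_empty_or_nonempty with h | ⟨z, hz⟩
    · rw [h, hX.val_empty]
      exact hR.one
    have heq : (t \ lo) ∩ hi = t ∩ r ⁻¹' {r z} := by
      ext x
      refine ⟨fun hx => ⟨hx.1.1, le_antisymm (hz.2 x hx.1.1) (hx.2 z hz.1.1)⟩,
        fun hx => ⟨⟨hx.1, fun h => hz.1.2 fun a ha => ?_⟩, fun b hb => ?_⟩⟩
      · rw [← show r x = r z from hx.2]
        exact h a ha
      · rw [show r x = r z from hx.2]
        exact hz.2 b hb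
    rw [heq]
    exact hval (hc.inter (hcls _)) (r z) fun x hx => hx.2

/-- A subalgebra of the algebra induced by a ⊛-monoid is closed under all countable products. -/
theorem Algebra.IsClosed.eval_mem (hR : X.IsClosed R) (hX : X.InducedBy π) (hπ : IsProduct π)
    {f : ι → M} (hf : ∀ i, f i ∈ R) : π (Word.of ι f) ∈ R := by
  rw [← val_univ (π := π)]
  exact hR.val_mem_of_linked hX hπ Set.ordConnected_univ fun x _ y _ => hR.linked hX hπ hf x y

end Generation

/-! ### Values of expressions -/

section Recognition

variable {A : Type u} {M : Type v} [Finite M] {X : Algebra M} {π : Word M → M} {h : Word A → M}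

theorem Algebra.InducedBy.apply_empty (hX : X.InducedBy π) (hh : IsMorphism Word.prod π h) :
    h (Expr.empty : Expr A).word = X.one := by
  rw [hX.one_eq, ← Word.of_eq_empty (fun i : Fin 0 => h (Fin.elim0 i))]
  exact (congrArg h (Word.prod_empty A).symm).trans (hh _)

theorem Algebra.InducedBy.apply_concat (hX : X.InducedBy π) (hh : IsMorphism Word.prod π h)
    (e f : Expr A) : h (e.concat f).word = X.mul (h e.word) (h f.word) := by
  rw [hX.mul_eq]
  refine (hh _).trans (congrArg (fun g => π (Word.of (Fin 2) g)) (funext fun i => ?_))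
  match i with
  | 0 => rfl
  | 1 => rfl

theorem Algebra.InducedBy.apply_omega (hX : X.InducedBy π) (hh : IsMorphism Word.prod π h)
    (e : Expr A) : h e.omega.word = X.tau (h e.word) :=
  (hh _).trans (hX.tau_eq (h e.word)).symm

theorem Algebra.InducedBy.apply_omegaOp (hX : X.InducedBy π) (hh : IsMorphism Word.prod π h)
    (e : Expr A) : h e.omegaOp.word = X.tauOp (h e.word) :=
  (hh _).trans (hX.tauOp_eq (h e.word)).symm

/-- Several arguments may have the same value; as every index occurs densely, so does every value.
-/
theorem Algebra.InducedBy.apply_shuffle (hX : X.InducedBy π) (hh : IsMorphism Word.prod π h)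
    {k : ℕ} (e : Fin (k + 1) → Expr A) (P : {P : Set M // P.Nonempty})
    (hP : P.1 = Set.range fun i => h (e i).word) :
    h (Expr.shuffle k e).word = X.kappa P := by
  refine (hh _).trans (hX.eval_shuffle P _ (fun q => ?_) fun a ha x y hxy => ?_)
  · rw [hP]
    exact ⟨_, rfl⟩
  · rw [hP] at ha
    obtain ⟨i, rfl⟩ := ha
    obtain ⟨z, h1, h2, h3⟩ :=
      (Word.exists_isShuffle (Fin (k + 1))).choose_spec i x y hxy
    exact ⟨z, h1, h2, congrArg (fun i => h (e i).word) h3⟩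

theorem Algebra.IsClosed.apply_mem {R : Set M} (hR : X.IsClosed R) (hX : X.InducedBy π)
    (hπ : IsProduct π) (hh : IsMorphism Word.prod π h) (hl : ∀ a, h (Word.single a) ∈ R)
    (w : Word A) : h w ∈ R := by
  obtain ⟨⟨ι, f⟩, rfl⟩ := Quotient.exists_rep w
  have : h (Word.of ι f) ∈ R := by
    rw [← Word.prod_of_single, hh]
    exact hR.eval_mem hX hπ fun i => hl (f i)
  exact this

end Recognition

/-! ### The saturation algorithm -/

/-- The codes listed in `s` with value `m`. -/
def select (s : List (ℕ × List ℕ)) (m : ℕ) : List (List ℕ) :=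
  s.flatMap fun p => if p.1 = m then [p.2] else []

/-- The concatenations of codes listed in `s` whose sequence of values is `l`. -/
def combine (s : List (ℕ × List ℕ)) (l : List ℕ) : List (List ℕ) :=
  l.foldr (fun m acc => (select s m).flatMap fun d => acc.map fun c => d ++ c) [[]]

/-- One round of saturation: the codes built by one operation from those of `s`, with their
values. -/
def saturate : InstanceCode → List (ℕ × List ℕ) → List (ℕ × List ℕ) :=
  fun I s =>
    s ++ ((I.2.1, [0]) ::
      -- The defaults of `getD` are never used when `I` codes an algebra and the values in `s` are
      -- numbers of elements.
      ((List.range I.2.2.2.2.2.2.1.length).map (fun i => (I.2.2.2.2.2.2.1.getD i 0, [1, i])) ++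
      (s.flatMap (fun p => s.map fun q =>
        ((I.2.2.1.getD p.1 []).getD q.1 0, 2 :: (p.2 ++ q.2))) ++
      (s.map (fun p => (I.2.2.2.1.getD p.1 0, 3 :: p.2)) ++
      (s.map (fun p => (I.2.2.2.2.1.getD p.1 0, 4 :: p.2)) ++
      I.2.2.2.2.2.1.flatMap fun P => (combine s P.1).map fun c =>
        -- A shuffle code stores one less than the number of arguments; listed sets are nonempty, so
        -- nothing is truncated.
        (P.2, 5 :: (P.1.length - 1) :: c))))))

/-- The codes found by saturation whose values lie in the accepting set. -/
def answers (I : InstanceCode) : List (List ℕ) :=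
  I.2.2.2.2.2.2.2.flatMap fun m => select ((saturate I)^[I.1] []) m

/-! ### Primitive recursiveness of saturation -/

section Computability

open Primrec

theorem primrec₂_select : Primrec₂ select :=
  list_flatMap fst
    (ite (Primrec.eq.comp (fst.comp snd) (snd.comp fst))
      (list_cons.comp (snd.comp snd) (const [])) (const []))

theorem primrec₂_combine : Primrec₂ combine :=
  list_foldr snd (const [[]])
    (list_flatMap (primrec₂_select.comp (fst.comp fst) (fst.comp snd))
      (list_map (snd.comp (snd.comp fst)) (list_append.comp (snd.comp fst) snd).to₂).to₂).to₂

theorem primrec₂_saturate : Primrec₂ saturate := by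
  have hI1 : Primrec fun x : InstanceCode × List (ℕ × List ℕ) => x.1.2 := snd.comp fst
  have hI2 : Primrec fun x : InstanceCode × List (ℕ × List ℕ) => x.1.2.2 := snd.comp hI1
  have hI3 : Primrec fun x : InstanceCode × List (ℕ × List ℕ) => x.1.2.2.2 := snd.comp hI2
  have hI4 : Primrec fun x : InstanceCode × List (ℕ × List ℕ) => x.1.2.2.2.2 := snd.comp hI3
  have hI5 : Primrec fun x : InstanceCode × List (ℕ × List ℕ) => x.1.2.2.2.2.2 := snd.comp hI4
  have hI6 : Primrec fun x : InstanceCode × List (ℕ × List ℕ) => x.1.2.2.2.2.2.2 := snd.comp hI5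
  refine list_append.comp snd (list_cons.comp (pair (fst.comp hI1) (const [0]))
    (list_append.comp ?_ (list_append.comp ?_ (list_append.comp ?_ (list_append.comp ?_ ?_)))))
  · exact list_map (list_range.comp (list_length.comp (fst.comp hI6)))
      (pair ((list_getD 0).comp ((fst.comp hI6).comp fst) snd)
        (list_cons.comp (const 1) (list_cons.comp snd (const []))))
  · exact list_flatMap snd (list_map (snd.comp fst)
      (pair ((list_getD 0).comp ((list_getD []).comp ((fst.comp hI2).comp (fst.comp fst))
          (fst.comp (snd.comp fst))) (fst.comp snd))
        (list_cons.comp (const 2)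
          (list_append.comp (snd.comp (snd.comp fst)) (snd.comp snd)))))
  · exact list_map snd (pair ((list_getD 0).comp ((fst.comp hI3).comp fst) (fst.comp snd))
      (list_cons.comp (const 3) (snd.comp snd)))
  · exact list_map snd (pair ((list_getD 0).comp ((fst.comp hI4).comp fst) (fst.comp snd))
      (list_cons.comp (const 4) (snd.comp snd)))
  · exact list_flatMap (fst.comp hI5)
      (list_map (primrec₂_combine.comp (snd.comp fst) (fst.comp snd))
        (pair (snd.comp (snd.comp fst)) (list_cons.comp (const 5) (list_cons.comp
          (nat_sub.comp (list_length.comp (fst.comp (snd.comp fst))) (const 1)) snd))))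

/-- The number of rounds is read off the instance, so no unbounded search occurs. -/
theorem primrec_answers : Primrec answers :=
  list_flatMap (snd.comp (snd.comp (snd.comp (snd.comp (snd.comp (snd.comp snd))))))
    (primrec₂_select.comp (nat_iterate (fst.comp fst) (const [])
      (primrec₂_saturate.comp (fst.comp fst) snd)) snd)

end Computability

/-! ### Soundness and completeness of saturation -/

section Correctness

theorem mem_select {s : List (ℕ × List ℕ)} {m : ℕ} {c : List ℕ} :
    c ∈ select s m ↔ (m, c) ∈ s := by
  simp only [select, List.mem_flatMap]
  constructor
  · rintro ⟨⟨a, d⟩, hp, hc⟩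
    split_ifs at hc with h
    · rw [List.mem_singleton] at hc
      subst hc
      exact h ▸ hp
    · simp at hc
  · intro h
    exact ⟨_, h, by simp⟩

theorem mem_combine_cons {s : List (ℕ × List ℕ)} {m : ℕ} {l : List ℕ} {c : List ℕ} :
    c ∈ combine s (m :: l) ↔ ∃ d, (m, d) ∈ s ∧ ∃ c' ∈ combine s l, c = d ++ c' := by
  simp only [combine, List.foldr_cons, List.mem_flatMap, mem_select, List.mem_map, eq_comm]

theorem exists_mem_combine {s : List (ℕ × List ℕ)} {l : List ℕ} (h : ∀ m ∈ l, ∃ d, (m, d) ∈ s) :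
    ∃ c, c ∈ combine s l := by
  induction l with
  | nil => exact ⟨[], by simp [combine]⟩
  | cons m l ih =>
    obtain ⟨c, hc⟩ := ih fun m' hm' => h m' (List.mem_cons_of_mem _ hm')
    obtain ⟨d, hd⟩ := h m List.mem_cons_self
    exact ⟨d ++ c, mem_combine_cons.2 ⟨d, hd, c, hc, rfl⟩⟩

theorem getD_map_map_finRange {M α : Type*} {n : ℕ} (e : M ≃ Fin n) (g : M → α) (m : M) (d : α) :
    (((List.finRange n).map e.symm).map g).getD (e m) d = g m := by
  simp [List.getD_eq_getElem?_getD]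

variable {A : Type u} {M : Type v} {k n : ℕ} (X : Algebra M) (h₀ : A → M)
  (F : Set M) (eA : A ≃ Fin k) (eM : M ≃ Fin n)

theorem mem_code_kappa {l : List ℕ} {m : ℕ} :
    (l, m) ∈ (X.code h₀ F eA eM).2.2.2.2.2.1 ↔
      ∃ l' ∈ ((List.finRange n).map eM.symm).sublists, ∃ hl : {x | x ∈ l'}.Nonempty,
        l = l'.map (fun x => (eM x : ℕ)) ∧ m = eM (X.kappa ⟨{x | x ∈ l'}, hl⟩) := by
  classical
  simp only [Algebra.code, List.mem_filterMap]
  refine exists_congr fun l' => and_congr_right fun _ => ?_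
  by_cases hl : {x | x ∈ l'}.Nonempty
  · rw [dif_pos hl]
    simp only [Option.some.injEq, Prod.mk.injEq, exists_prop_of_true hl, eq_comm]
  · rw [dif_neg hl]
    simp only [reduceCtorEq, false_iff]
    rintro ⟨h, -⟩
    exact hl h

variable {π : Word M → M} {h : Word A → M}

variable (h) in
/-- Every entry of `s` consists of the code of an expression and its value. -/
def IsSound (s : List (ℕ × List ℕ)) : Prop :=
  ∀ p ∈ s, ∃ e : Expr A, p = ((eM (h e.word) : ℕ), e.code fun a => (eA a : ℕ))

theorem IsSound.exists_of_mem_combine {s : List (ℕ × List ℕ)} (hs : IsSound eA eM h s)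
    {l : List M} {c : List ℕ} (hc : c ∈ combine s (l.map fun x => (eM x : ℕ))) :
    ∃ es : List (Expr A), es.map (fun e => h e.word) = l ∧
      c = (es.map fun e => e.code fun a => (eA a : ℕ)).flatten := by
  induction l generalizing c with
  | nil => exact ⟨[], rfl, by simpa [combine] using hc⟩
  | cons m l ih =>
    obtain ⟨d, hd, c', hc', rfl⟩ := mem_combine_cons.1 hc
    obtain ⟨es, rfl, rfl⟩ := ih hc'
    obtain ⟨e, he⟩ := hs _ hd
    obtain ⟨h1, rfl⟩ := Prod.mk.inj he
    exact ⟨e :: es, by rw [List.map_cons, eM.injective (Fin.ext h1)], rfl⟩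

/-- Each rule of a round applies one constructor of `Expr` to codes and the matching algebra
operation to values. -/
theorem IsSound.saturate [Finite M] (hX : X.InducedBy π) (hh : IsMorphism Word.prod π h)
    (hl : ∀ a, h (Word.single a) = h₀ a) {s : List (ℕ × List ℕ)} (hs : IsSound eA eM h s) :
    IsSound eA eM h (saturate (X.code h₀ F eA eM) s) := by
  intro p hp
  simp only [OStar.saturate, List.mem_append, List.mem_cons, List.mem_map, List.mem_flatMap] at hp
  rcases hp with hp | rfl | ⟨i, hi, rfl⟩ | ⟨p, hp, q, hq, rfl⟩ | ⟨p, hp, rfl⟩ | ⟨p, hp, rfl⟩ |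
    ⟨⟨l, m⟩, hm, c, hc, rfl⟩
  · exact hs p hp
  · exact ⟨Expr.empty, by rw [hX.apply_empty hh]; rfl⟩
  · have hik : i < k := by simpa [Algebra.code] using hi
    refine ⟨Expr.letter (eA.symm ⟨i, hik⟩), Prod.ext ?_ ?_⟩
    · refine Eq.trans ?_ (congrArg (fun m => (eM m : ℕ)) (hl _).symm)
      have := getD_map_map_finRange eA (fun a => (eM (h₀ a) : ℕ)) (eA.symm ⟨i, hik⟩) 0
      rwa [Equiv.apply_symm_apply] at this
    · simp [Expr.code]
  · obtain ⟨e, rfl⟩ := hs p hp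
    obtain ⟨f, rfl⟩ := hs q hq
    refine ⟨e.concat f, Prod.ext ?_ rfl⟩
    rw [hX.apply_concat hh]
    refine Eq.trans (congrArg (fun l : List ℕ => l.getD _ 0) (getD_map_map_finRange eM _ _ _)) ?_
    exact getD_map_map_finRange eM (fun b => (eM (X.mul (h e.word) b) : ℕ)) _ _
  · obtain ⟨e, rfl⟩ := hs p hp
    refine ⟨e.omega, Prod.ext ?_ rfl⟩
    rw [hX.apply_omega hh]
    exact getD_map_map_finRange eM (fun b => (eM (X.tau b) : ℕ)) _ _
  · obtain ⟨e, rfl⟩ := hs p hp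
    refine ⟨e.omegaOp, Prod.ext ?_ rfl⟩
    rw [hX.apply_omegaOp hh]
    exact getD_map_map_finRange eM (fun b => (eM (X.tauOp b) : ℕ)) _ _
  · obtain ⟨l, -, hne, rfl, rfl⟩ := (mem_code_kappa X h₀ F eA eM).1 hm
    obtain ⟨es, rfl, rfl⟩ := hs.exists_of_mem_combine eA eM hc
    cases es with
    | nil =>
      obtain ⟨x, hx⟩ := hne
      simp at hx
    | cons e es =>
      refine ⟨Expr.shuffle es.length (e :: es).get, Prod.ext ?_ ?_⟩
      · rw [hX.apply_shuffle hh (e :: es).get ⟨_, hne⟩]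
        ext x
        simp only [Set.mem_ofPred_eq, List.mem_map, Set.mem_range]
        constructor
        · rintro ⟨f, hf, rfl⟩
          obtain ⟨i, rfl⟩ := List.get_of_mem hf
          exact ⟨i, rfl⟩
        · rintro ⟨i, rfl⟩
          exact ⟨_, List.get_mem (e :: es) i, rfl⟩
      · have hcode : (List.ofFn fun i : Fin (es.length + 1) =>
            ((e :: es).get i).code fun a => (eA a : ℕ)) =
            (e :: es).map fun e => e.code fun a => (eA a : ℕ) := by
          conv_rhs => rw [← List.ofFn_get (e :: es), List.map_ofFn]
          rfl
        simp only [Expr.code, hcode, List.length_map, List.length_cons, Nat.add_sub_cancel]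

/-- The elements occurring as values in `s`. -/
def values (s : List (ℕ × List ℕ)) : Set M :=
  {m | ∃ c, ((eM m : ℕ), c) ∈ s}

theorem values_subset_saturate (s : List (ℕ × List ℕ)) :
    values eM s ⊆ values eM (saturate (X.code h₀ F eA eM) s) :=
  fun _ ⟨c, hc⟩ => ⟨c, List.mem_append_left _ hc⟩

theorem letter_mem_values_saturate (s : List (ℕ × List ℕ)) (a : A) :
    h₀ a ∈ values eM (saturate (X.code h₀ F eA eM) s) := by
  refine ⟨[1, eA a], ?_⟩
  simp only [saturate, List.mem_append, List.mem_cons, List.mem_map]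
  refine Or.inr (Or.inr (Or.inl ⟨eA a, ?_, Prod.ext ?_ rfl⟩))
  · simp [Algebra.code]
  · exact getD_map_map_finRange eA (fun a => (eM (h₀ a) : ℕ)) _ _

/-- A round that finds no new value certifies closure under every operation. -/
theorem isClosed_values {s : List (ℕ × List ℕ)}
    (hs : values eM (saturate (X.code h₀ F eA eM) s) ⊆ values eM s) :
    X.IsClosed (values eM s) := by
  have key : ∀ m c, ((eM m : ℕ), c) ∈ saturate (X.code h₀ F eA eM) s → m ∈ values eM s :=
    fun m c hc => hs ⟨c, hc⟩
  simp only [saturate, List.mem_append, List.mem_cons, List.mem_map, List.mem_flatMap] at key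
  refine ⟨?_, ?_, ?_, ?_, ?_⟩
  · exact key X.one [0] (Or.inr (Or.inl rfl))
  · rintro a ⟨c, hc⟩ b ⟨d, hd⟩
    refine key _ (2 :: (c ++ d))
      (Or.inr (Or.inr (Or.inr (Or.inl ⟨_, hc, _, hd, Prod.ext ?_ rfl⟩))))
    refine Eq.trans (congrArg (fun l : List ℕ => l.getD _ 0) (getD_map_map_finRange eM _ _ _)) ?_
    exact getD_map_map_finRange eM (fun b => (eM (X.mul a b) : ℕ)) _ _
  · rintro a ⟨c, hc⟩
    refine key _ (3 :: c) (Or.inr (Or.inr (Or.inr (Or.inr (Or.inl ⟨_, hc, Prod.ext ?_ rfl⟩)))))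
    exact getD_map_map_finRange eM (fun b => (eM (X.tau b) : ℕ)) _ _
  · rintro a ⟨c, hc⟩
    refine key _ (4 :: c)
      (Or.inr (Or.inr (Or.inr (Or.inr (Or.inr (Or.inl ⟨_, hc, Prod.ext ?_ rfl⟩))))))
    exact getD_map_map_finRange eM (fun b => (eM (X.tauOp b) : ℕ)) _ _
  · rintro ⟨P, hP⟩ hPs
    classical
    -- The table of `κ` is indexed by sublists of the enumeration of `M`; this is the one listing
    -- `P`.
    let l : List M := ((List.finRange n).map eM.symm).filter fun x => x ∈ P
    have hl : {x | x ∈ l} = P := by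
      ext x
      simp only [l, Set.mem_ofPred_eq, List.mem_filter, List.mem_map, List.mem_finRange, true_and,
        decide_eq_true_eq]
      exact ⟨fun hx => hx.2, fun hx => ⟨⟨eM x, eM.symm_apply_apply x⟩, hx⟩⟩
    obtain ⟨c, hc⟩ := exists_mem_combine (s := s) (l := l.map fun x => (eM x : ℕ)) (by
      intro m hm
      obtain ⟨x, hx, rfl⟩ := List.mem_map.1 hm
      exact hPs (hl.le hx))
    refine key _ _ (Or.inr (Or.inr (Or.inr (Or.inr (Or.inr (Or.inr
      ⟨_, (mem_code_kappa X h₀ F eA eM).2 ⟨l, ?_, hl.symm ▸ hP, rfl, rfl⟩, c, hc,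
        Prod.ext ?_ rfl⟩))))))
    · exact List.mem_sublists.2 List.filter_sublist
    · simp only [hl]

/-- After as many rounds as there are elements, saturation has found the values of all words. -/
theorem apply_mem_values_iterate [Finite M] (hX : X.InducedBy π) (hπ : IsProduct π)
    (hh : IsMorphism Word.prod π h) (hl : ∀ a, h (Word.single a) = h₀ a) (w : Word A) :
    h w ∈ values eM ((saturate (X.code h₀ F eA eM))^[n] []) := by
  let V : ℕ → Set M := fun j => values eM ((saturate (X.code h₀ F eA eM))^[j] [])
  have hsucc : ∀ j, V (j + 1) = values eM
      (saturate (X.code h₀ F eA eM) ((saturate (X.code h₀ F eA eM))^[j] [])) := fun j => by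
    simp only [V, Function.iterate_succ_apply']
  have hmono : Monotone V := monotone_nat_of_le_succ fun j => by
    rw [hsucc]
    exact values_subset_saturate X h₀ F eA eM _
  -- A chain of subsets of an `n`-element set cannot grow strictly `n + 1` times.
  obtain ⟨j, hj, hfix⟩ : ∃ j ≤ n, V (j + 1) ⊆ V j := by
    by_contra hno
    push Not at hno
    have hcard : ∀ j ≤ n + 1, j ≤ (V j).ncard := by
      intro j
      induction j with
      | zero => exact fun _ => Nat.zero_le _
      | succ j ih =>
        intro hj
        have hlt : (V j).ncard < (V (j + 1)).ncard :=
          Set.ncard_lt_ncard ⟨hmono (Nat.le_succ j), hno j (by omega)⟩ (Set.toFinite _)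
        have := ih (by omega)
        omega
    have h1 := hcard (n + 1) le_rfl
    have h2 : (V (n + 1)).ncard ≤ n := by
      refine (Set.ncard_le_ncard (Set.subset_univ _) (Set.toFinite _)).trans ?_
      rw [Set.ncard_univ, Nat.card_congr eM, Nat.card_fin]
    omega
  refine hmono hj ?_
  rw [hsucc] at hfix
  refine (isClosed_values X h₀ F eA eM hfix).apply_mem hX hπ hh (fun a => ?_) w
  rw [hl]
  exact hfix (letter_mem_values_saturate X h₀ F eA eM _ a)

variable {X h₀ F} {L : Set (Word A)}

theorem mem_answers {c : List ℕ} : c ∈ answers (X.code h₀ F eA eM) ↔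
    ∃ m ∈ F, ((eM m : ℕ), c) ∈ (saturate (X.code h₀ F eA eM))^[n] [] := by
  classical
  have hF : ∀ x, x ∈ (X.code h₀ F eA eM).2.2.2.2.2.2.2 ↔ ∃ m ∈ F, (eM m : ℕ) = x := by
    intro x
    simp only [Algebra.code, List.mem_map, List.mem_filter, List.mem_finRange, true_and,
      decide_eq_true_eq]
    exact ⟨fun ⟨m, hm, hx⟩ => ⟨m, hm.2, hx⟩,
      fun ⟨m, hm, hx⟩ => ⟨m, ⟨⟨eM m, eM.symm_apply_apply m⟩, hm⟩, hx⟩⟩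
  simp only [answers, List.mem_flatMap, mem_select, hF]
  constructor
  · rintro ⟨_, ⟨m, hm, rfl⟩, hc⟩
    exact ⟨m, hm, hc⟩
  · rintro ⟨m, hm, hc⟩
    exact ⟨_, ⟨m, hm, rfl⟩, hc⟩

theorem Algebra.Recognizes.exists_expr_of_mem_answers [Finite M] (hL : X.Recognizes h₀ F L)
    {c : List ℕ} (hc : c ∈ answers (X.code h₀ F eA eM)) :
    ∃ e : Expr A, c = e.code (fun a => (eA a : ℕ)) ∧ e.word ∈ L := by
  obtain ⟨π, -, hX, h, hh, hl, rfl⟩ := hL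
  have hsound : ∀ j, IsSound eA eM h ((saturate (X.code h₀ F eA eM))^[j] []) := by
    intro j
    induction j with
    | zero => exact fun p hp => absurd hp List.not_mem_nil
    | succ j ih =>
      rw [Function.iterate_succ_apply']
      exact ih.saturate X h₀ F eA eM hX hh hl
  obtain ⟨m, hm, hc⟩ := (mem_answers eA eM).1 hc
  obtain ⟨e, he⟩ := hsound n _ hc
  obtain ⟨h1, rfl⟩ := Prod.mk.inj he
  refine ⟨e, rfl, ?_⟩
  rw [eM.injective (Fin.ext h1)] at hm
  exact hm

theorem Algebra.Recognizes.answers_ne_nil [Finite M] (hL : X.Recognizes h₀ F L) (hne : L ≠ ∅) :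
    answers (X.code h₀ F eA eM) ≠ [] := by
  obtain ⟨π, hπ, hX, h, hh, hl, rfl⟩ := hL
  obtain ⟨w, hw⟩ := Set.nonempty_iff_ne_empty.2 hne
  obtain ⟨c, hc⟩ := apply_mem_values_iterate X h₀ F eA eM hX hπ hh hl w
  exact List.ne_nil_of_mem ((mem_answers eA eM).2 ⟨_, hw, hc⟩)

end Correctness

end OStar

theorem mainTheorem2 :
    (∃ d : OStar.InstanceCode → Bool, Computable d ∧
      ∀ (A : Type u) (M : Type v) [Finite M] (k n : ℕ) (eA : A ≃ Fin k) (eM : M ≃ Fin n)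
        (X : OStar.Algebra M) (h₀ : A → M) (F : Set M) (L : Set (OStar.Word A)),
        X.Recognizes h₀ F L →
          (d (X.code h₀ F eA eM) = true ↔ L ≠ ∅)) ∧
    (∃ g : OStar.InstanceCode → List ℕ, Computable g ∧
      ∀ (A : Type u) (M : Type v) [Finite M] (k n : ℕ) (eA : A ≃ Fin k) (eM : M ≃ Fin n)
        (X : OStar.Algebra M) (h₀ : A → M) (F : Set M) (L : Set (OStar.Word A)),
        X.Recognizes h₀ F L → L ≠ ∅ →
          ∃ e : OStar.Expr A, g (X.code h₀ F eA eM) = e.code (fun a => (eA a : ℕ)) ∧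
            e.word ∈ L) := by
  constructor
  · refine ⟨fun I => (OStar.answers I).head?.isSome,
      (Primrec.option_isSome.comp (Primrec.list_head?.comp OStar.primrec_answers)).to_comp, ?_⟩
    intro A M _ k n eA eM X h₀ F L hL
    rw [List.isSome_head?]
    constructor
    · intro hne
      obtain ⟨c, hc⟩ := List.exists_mem_of_ne_nil _ (by simpa using hne)
      obtain ⟨e, -, he⟩ := hL.exists_expr_of_mem_answers eA eM hc
      exact Set.nonempty_iff_ne_empty.1 ⟨_, he⟩
    · intro hne
      simpa using hL.answers_ne_nil eA eM hne
  -- The default `[]` of `headI` arises only for an empty list, excluded when `L ≠ ∅`.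
  · refine ⟨fun I => (OStar.answers I).headI,
      (Primrec.list_headI.comp OStar.primrec_answers).to_comp, ?_⟩
    intro A M _ k n eA eM X h₀ F L hL hne
    refine hL.exists_expr_of_mem_answers eA eM ?_
    cases h : OStar.answers (X.code h₀ F eA eM) with
    | nil => exact absurd h (hL.answers_ne_nil eA eM hne)
    | cons c l =>
      simp only [h]
      exact List.mem_cons_self
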